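/- Let $\mathcal M=(n,\mathcal S,\mathcal A_1\times\dots\times\mathcal A_n,P,\{r_i\},\gamma,\rho)$ be a stochastic game with $n\ge 1$ agents, finite state space $\mathcal S$, finite nonempty action sets $\mathcal A_i$, rewards $r_i\in[0,1]$, discount factor $\gamma\in(0,1)$ and initial distribution $\rho$. Policies are decentralized: $\pi(\boldsymbol a|s)=\prod_i\pi_i(a_i|s)$. Write $V_i^\pi(s)$ for the discounted value of agent $i$, $V_i^\pi(\rho)=\mathbb E_{s\sim\rho}V_i^\pi(s)$, $\bar A_i^\pi(s,a_i)$ for the advantage $A_i^\pi(s,\boldsymbol a)=Q_i^\pi(s,\boldsymbol a)-V_i^\pi(s)$ averaged over $a_{-i}\sim\pi_{-i}(\cdot|s)$, and $d_\rho^\pi(s)=(1-\gamma)\sum_{t\ge0}\gamma^t\Pr^\pi(s^t=s\mid s^0\sim\rho)$. Let $\text{NE-gap}(\pi)=\max_{i,\pi_i'}[V_i^{\pi_i',\pi_{-i}}(\rho)-V_i^{\pi}(\rho)]$. Suppose that: (a) $\mathcal M$ is a Markov potential game in the following sense: there is a function $\Phi^\pi(s)$ of policies and states with $V_i^{\pi_i,\pi_{-i}}(s)-V_i^{\pi_i',\pi_{-i}}(s)=\Phi^{\pi_i,\pi_{-i}}(s)-\Phi^{\pi_i',\pi_{-i}}(s)$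 for all $i,s,\pi_i,\pi_i',\pi_{-i}$; and $\phi_{max}$ is such that $0\le\Phi^\pi(s)\le\phi_{max}/(1-\gamma)$ for all $\pi,s$; (b) $\inf_\pi\min_s d_\rho^\pi(s)>0$, and $M:=\sup_\pi\max_s 1/d_\rho^\pi(s)$; (c) stationary policies are isolated, where a policy (possibly with zero entries) is stationary if for all $i,s,a_i$ the derivative of $V_i(\rho)$ in the softmax parameter (logit) of $\pi_i(a_i|s)$ is zero. Let $\pi^0$ be any softmax policy, let $\eta=\frac{(1-\gamma)^2}{4nM^3\max_i|\mathcal A_i|}$, and let $\pi^k$ be the iterates of independent natural policy gradient, $\pi_i^{k+1}(a_i|s)\propto\pi_i^k(a_i|s)\exp\big(\eta\bar A_i^{\pi^k}(s,a_i)/(1-\gamma)\big)$. Let $\mathcal A_{i}^k(s)=\arg\max_{a}\bar A_i^{\pi^k}(s,a)$, let $\delta^k$ be the minimum over $i,s$ (with $\mathcal A_i^k(s)\neq\mathcal A_i$) of the difference between the largest and the second largest value of $\bar A_i^{\pi^k}(s,\cdot)$, let $c=\inf_{i,s,k}\sum_{a\in\mathcal A_i^k(s)}\pi_i^k(a|s)$,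 and suppose that (d) $\lim_{k\to\infty}\delta^k=\delta^*>0$. Then $c\in(0,1)$; there is $K'$ with $|\delta^k-\delta^*|\le\delta^*/2$ for all $k\ge K'$; and for every such $K'$ and every $K\ge1$, $$\frac1K\sum_{k=0}^{K-1}\text{NE-gap}(\pi^k)\le\frac{2M\phi_{max}}{K(1-\gamma)}\left(1+\frac{8nM^3\max_i|\mathcal A_i|}{c\,\delta^*(1-\gamma)}+\frac{K'}{2M}\right).$$ -/

import Mathlib

open Filter Topology

noncomputable section

/-- A finite discounted stochastic game with agents `Fin n`, states `S`, local action sets `A i`,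
transition kernel `P`, rewards `r i` valued in `[0, 1]`, discount factor `γ ∈ (0, 1)` and
initial state distribution `ρ`. -/
structure StochasticGame (n : ℕ) (S : Type*) (A : Fin n → Type*) [Fintype S] where
  P : S → (∀ i, A i) → S → ℝ
  P_mem : ∀ s a, P s a ∈ stdSimplex ℝ S
  r : Fin n → S → (∀ i, A i) → ℝ
  r_mem : ∀ i s a, r i s a ∈ Set.Icc (0 : ℝ) 1
  γ : ℝ
  γ_mem : γ ∈ Set.Ioo (0 : ℝ) 1
  ρ : S → ℝ
  ρ_mem : ρ ∈ stdSimplex ℝ S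

/-- A family of local rules `π i s a`, read as `π_i(a | s)`; it is a policy when it belongs to
`policySet`. -/
abbrev Profile {n : ℕ} (S : Type*) (A : Fin n → Type*) : Type _ := ∀ i : Fin n, S → A i → ℝ

/-- The local (Markov, stochastic) policies `S → Δ(B)` of one agent with action set `B`. -/
def localPolicySet (S B : Type*) [Fintype B] : Set (S → B → ℝ) :=
  {p | ∀ s, p s ∈ stdSimplex ℝ B}

/-- The decentralized policies: every agent has a local policy. -/
def policySet {n : ℕ} (S : Type*) (A : Fin n → Type*) [∀ i, Fintype (A i)] :
    Set (Profile S A) :=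
  {π | ∀ i, π i ∈ localPolicySet S (A i)}

/-- The softmax policy with parameters `θ`. -/
def softmaxPolicy {n : ℕ} {S : Type*} {A : Fin n → Type*} [∀ i, Fintype (A i)]
    (θ : Profile S A) : Profile S A :=
  fun i s a => Real.exp (θ i s a) / ∑ b, Real.exp (θ i s b)

/-- The local policy obtained from `p` by adding `t` to the softmax parameter (logit) of the pair
`(s, a)`: only `p s` changes, to the distribution proportional to `p s b * exp (t * 1[b = a])`.
For `p = softmax θ` this is the softmax policy of `θ + t e_{s,a}`; the formula makes sense for
policies with zero entries too. -/
def shiftLogit {S B : Type*} [Fintype B] (p : S → B → ℝ) (s : S) (a : B) (t : ℝ) : S → B → ℝ :=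
  open scoped Classical in
  fun s' b =>
    if s' = s then
      p s b * Real.exp (if b = a then t else 0) /
        ∑ b', p s b' * Real.exp (if b' = a then t else 0)
    else p s' b

/-- `max_i |A_i|`. -/
def maxActions {n : ℕ} (A : Fin n → Type*) [∀ i, Fintype (A i)] : ℕ :=
  Finset.univ.sup fun i => Fintype.card (A i)

namespace StochasticGame

variable {n : ℕ} {S : Type*} {A : Fin n → Type*} [Fintype S] [∀ i, Fintype (A i)]
variable (G : StochasticGame n S A)

/-- The joint law of `(s^t, a^t)` under `π` when `(s^0, a^0)` has law `x`:
`s^{t+1} ∼ P(· | s^t, a^t)`, and then `a^{t+1}_i ∼ π_i(· | s^{t+1})`, independently over `i`. -/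
def law (π : Profile S A) (x : S → (∀ i, A i) → ℝ) : ℕ → S → (∀ i, A i) → ℝ
  | 0 => x
  | t + 1 => fun s' a' =>
      (∑ s, ∑ a, law π x t s a * G.P s a s') * ∏ i, π i s' (a' i)

/-- The law of `(s^0, a^0)` when `s^0 ∼ μ` and `a^0 ∼ π(· | s^0)`. -/
def start (π : Profile S A) (μ : S → ℝ) : S → (∀ i, A i) → ℝ :=
  fun s a => μ s * ∏ i, π i s (a i)

/-- The point mass at a state. -/
def pointState (s : S) : S → ℝ :=
  open scoped Classical in fun s' => if s' = s then 1 else 0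

/-- The point mass at a state-action pair. -/
def pointPair (s : S) (a : ∀ i, A i) : S → (∀ i, A i) → ℝ :=
  open scoped Classical in fun s' a' => if s' = s ∧ a' = a then 1 else 0

/-- The expected discounted reward `E^π[∑_t γ^t r_i(s^t, a^t)]` when `(s^0, a^0)` has law `x`. -/
def discounted (i : Fin n) (π : Profile S A) (x : S → (∀ i, A i) → ℝ) : ℝ :=
  ∑' t : ℕ, G.γ ^ t * ∑ s, ∑ a, G.law π x t s a * G.r i s a

/-- The state value `V_i^π(s)`. -/
def value (i : Fin n) (π : Profile S A) (s : S) : ℝ :=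
  G.discounted i π (start π (pointState s))

/-- The value `V_i^π(ρ)` under the initial distribution. -/
def valueInit (i : Fin n) (π : Profile S A) : ℝ :=
  ∑ s, G.ρ s * G.value i π s

/-- The state-action value `Q_i^π(s, a)`. -/
def qValue (i : Fin n) (π : Profile S A) (s : S) (a : ∀ i, A i) : ℝ :=
  G.discounted i π (pointPair s a)

/-- The advantage `A_i^π(s, a) = Q_i^π(s, a) - V_i^π(s)`. -/
def advantage (i : Fin n) (π : Profile S A) (s : S) (a : ∀ i, A i) : ℝ :=
  G.qValue i π s a - G.value i π s

/-- The marginalized advantage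
`Ā_i^π(s, b) = ∑_{a_{-i}} π_{-i}(a_{-i} | s) A_i^π(s, b, a_{-i})`; the sum runs over the joint
actions whose `i`-th component is `b`. -/
def margAdv (i : Fin n) (π : Profile S A) (s : S) (b : A i) : ℝ :=
  open scoped Classical in
  ∑ a : (∀ j, A j) with a i = b,
    (∏ j ∈ Finset.univ.erase i, π j s (a j)) * G.advantage i π s a

/-- The discounted state visitation distribution `d_ρ^π(s)`. -/
def visitation (π : Profile S A) (s : S) : ℝ :=
  (1 - G.γ) * ∑' t : ℕ, G.γ ^ t * ∑ a, G.law π (start π G.ρ) t s a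

/-- Sufficient exploration: `inf_π min_s d_ρ^π(s) > 0`. -/
def Explores : Prop :=
  ∃ ε > 0, ∀ π ∈ policySet S A, ∀ s, ε ≤ G.visitation π s

/-- The distribution mismatch coefficient `M = sup_π max_s 1 / d_ρ^π(s)`. -/
def mismatch : ℝ :=
  sSup {x | ∃ π ∈ policySet S A, ∃ s, x = 1 / G.visitation π s}

/-- `NE-gap(π)`: the supremum over agents `i` and local policies `π_i'` of
`V_i^{π_i', π_{-i}}(ρ) - V_i^π(ρ)`. -/
def neGap (π : Profile S A) : ℝ :=
  sSup {x | ∃ i, ∃ p ∈ localPolicySet S (A i),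
    x = G.valueInit i (Function.update π i p) - G.valueInit i π}

/-- `Φ` is a global potential of the game: at every state a unilateral change of policy changes
the value of the deviating agent and `Φ` by the same amount. -/
def IsPotential (Φ : Profile S A → S → ℝ) : Prop :=
  ∀ (i : Fin n) (s : S), ∀ π ∈ policySet S A, ∀ p ∈ localPolicySet S (A i),
    G.value i (Function.update π i p) s - G.value i π s =
      Φ (Function.update π i p) s - Φ π s

/-- The policies with zero softmax policy gradient: for every agent `i`, state `s` and action `a`,
the derivative of `V_i(ρ)` in the softmax parameter `[θ_i]_{s,a}` vanishes. -/
def stationarySet : Set (Profile S A) :=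
  {π | π ∈ policySet S A ∧ ∀ (i : Fin n) (s : S) (a : A i),
    HasDerivAt (fun t : ℝ => G.valueInit i (Function.update π i (shiftLogit (π i) s a t))) 0 0}

/-- Every stationary policy has a neighbourhood that contains no other stationary policy. -/
def IsolatedStationary : Prop :=
  ∀ π ∈ G.stationarySet, ∃ U ∈ 𝓝 π, ∀ π' ∈ U, π' ∈ G.stationarySet → π' = π

/-- One step of independent natural policy gradient with step size `η`:
`π_i'(a | s) ∝ π_i(a | s) exp(η Ā_i^π(s, a) / (1 - γ))`. -/
def npgStep (η : ℝ) (π : Profile S A) : Profile S A :=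
  fun i s a =>
    π i s a * Real.exp (η * G.margAdv i π s a / (1 - G.γ)) /
      ∑ b, π i s b * Real.exp (η * G.margAdv i π s b / (1 - G.γ))

/-- The iterates `π^k` of independent natural policy gradient, started at the policy `π₀`. -/
def npg (η : ℝ) (π₀ : Profile S A) : ℕ → Profile S A
  | 0 => π₀
  | k + 1 => G.npgStep η (npg η π₀ k)

/-- The maximizers of `Ā_i^π(s, ·)`. -/
def bestActions (i : Fin n) (π : Profile S A) (s : S) : Finset (A i) :=
  open scoped Classical in
  {a : A i | ∀ b, G.margAdv i π s b ≤ G.margAdv i π s a}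

/-- The suboptimality gap of `π`: the minimum over `i` and `s` of the difference between the
largest and the second largest value of `Ā_i^π(s, ·)`. It is written as the minimum over all
`a ∈ bestActions`, `b ∉ bestActions`, so a pair `(i, s)` for which all actions are maximizers
(and which has no second largest value) imposes no constraint. -/
def subGap (π : Profile S A) : ℝ :=
  sInf {x | ∃ (i : Fin n) (s : S), ∃ a ∈ G.bestActions i π s, ∃ b ∉ G.bestActions i π s,
    x = G.margAdv i π s a - G.margAdv i π s b}

/-- The infimum over agents, states and all `k` of the probability that the `k`-th policy of the
sequence `π` gives to the maximizers of its marginalized advantage. -/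
def bestMass (π : ℕ → Profile S A) : ℝ :=
  ⨅ q : Fin n × S × ℕ, ∑ a ∈ G.bestActions q.1 (π q.2.2) q.2.1, π q.2.2 q.1 q.2.1 a

end StochasticGame

end

/-! Measure the progress of an iterate by the mean advantage each agent obtains from its own updated
policy, summed over agents and states (`totalGain`). The theorem compares this quantity with the
potential and with the NE-gap.

Potential. The update is an exponential reweighting, so its squared displacement is bounded by its
gain (`sum_sq_expTilt_sub_le`). Let the agents switch one at a time; each switch changes the
potential by the change of the switching agent's value, which the performance difference lemma
expresses through advantages at the current hybrid profile. These differ from the advantages at `π`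
by an action-independent shift, which is harmless, plus an error linear in the displacement
(`abs_margAdv_add_sub_le`). The total error is therefore quadratic in the displacement, hence linear
in the gain, and `η` makes it at most half of the main term (`totalGain_le_potentialInit_sub`).
Telescoping bounds the sum of all gains by `2 M φmax`.

NE-gap. If the best actions have mass at least `c` and lead by `δ`, the largest marginalized
advantage is at most `1 + 1 / (c x δ)` times the gain, where `x = η / (1 - γ)`
(`max_le_mul_sum_expTilt`). This controls the NE-gap once the gap is at least `δ* / 2`; each earlier
iterate costs at most the range of the potential.

Positivity of `c`. Summable gains force the steps to zero. With gaps bounded below, the sets of best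
actions are eventually constant, and on a fixed set of best actions the update never loses mass. The
infimum is thus attained among finitely many positive numbers (`bestMass_pos_of_summable`). -/

/-! ### Expectations under product distributions. -/

section ProductMean

variable {n : ℕ} {A : Fin n → Type*} [∀ i, Fintype (A i)]

/-- The expectation of `f` under the product of the weights `q i`. -/
def prodMean (q : ∀ i, A i → ℝ) (f : (∀ i, A i) → ℝ) : ℝ :=
  ∑ a, (∏ i, q i (a i)) * f a

lemma sum_prod_apply (q : ∀ i, A i → ℝ) :
    ∑ a : ∀ i, A i, ∏ i, q i (a i) = ∏ i, ∑ b, q i b := by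
  rw [Finset.prod_univ_sum, Fintype.piFinset_univ]

lemma sum_prod_apply_eq_one {q : ∀ i, A i → ℝ} (hq : ∀ i, q i ∈ stdSimplex ℝ (A i)) :
    ∑ a : ∀ i, A i, ∏ i, q i (a i) = 1 := by
  rw [sum_prod_apply, Finset.prod_eq_one fun i _ => (hq i).2]

lemma prod_apply_nonneg {q : ∀ i, A i → ℝ} (hq : ∀ i, q i ∈ stdSimplex ℝ (A i))
    (a : ∀ i, A i) : 0 ≤ ∏ i, q i (a i) :=
  Finset.prod_nonneg fun i _ => (hq i).1 _

omit [∀ i, Fintype (A i)] in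
lemma prod_update_apply (q : ∀ i, A i → ℝ) (k : Fin n) (p : A k → ℝ) (a : ∀ i, A i) :
    ∏ i, Function.update q k p i (a i) = p (a k) * ∏ i ∈ Finset.univ.erase k, q i (a i) := by
  rw [← Finset.mul_prod_erase Finset.univ _ (Finset.mem_univ k), Function.update_self]
  congr 1
  refine Finset.prod_congr rfl fun i hi => ?_
  rw [Function.update_of_ne (Finset.ne_of_mem_erase hi)]

lemma update_mem_stdSimplex {q : ∀ i, A i → ℝ} (hq : ∀ i, q i ∈ stdSimplex ℝ (A i))
    (k : Fin n) {p : A k → ℝ} (hp : p ∈ stdSimplex ℝ (A k)) (i : Fin n) :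
    Function.update q k p i ∈ stdSimplex ℝ (A i) := by
  rcases eq_or_ne i k with rfl | h
  · simpa using hp
  · simpa [Function.update_of_ne h] using hq i

/-- The `ℓ¹` distance of product distributions is at most the sum of the `ℓ¹` distances of the
factors. -/
lemma sum_abs_prod_sub_prod_le {p q : ∀ i, A i → ℝ} (hp : ∀ i, p i ∈ stdSimplex ℝ (A i))
    (hq : ∀ i, q i ∈ stdSimplex ℝ (A i)) :
    ∑ a : ∀ i, A i, |∏ i, p i (a i) - ∏ i, q i (a i)| ≤ ∑ i, ∑ b, |p i b - q i b| := by
  -- Factors are exchanged one at a time, with `s` the set already exchanged.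
  have key : ∀ s : Finset (Fin n),
      ∑ a : ∀ i, A i, |∏ i, (if i ∈ s then p i else q i) (a i) - ∏ i, q i (a i)| ≤
        ∑ i ∈ s, ∑ b, |p i b - q i b| := by
    intro s
    induction s using Finset.induction_on with
    | empty => simp
    | insert k s hk ih =>
      set h : ∀ i, A i → ℝ := fun i => if i ∈ s then p i else q i with hh
      have hmem : ∀ i, h i ∈ stdSimplex ℝ (A i) := by
        intro i
        by_cases hi : i ∈ s <;> simp only [hh, hi, if_true, if_false]
        · exact hp i
        · exact hq i
      have hup : (fun i => if i ∈ insert k s then p i else q i) = Function.update h k (p k) := by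
        funext i
        rcases eq_or_ne i k with rfl | hik
        · simp
        · simp [hh, hik]
      have hup' : ∀ i, (if i ∈ insert k s then p i else q i) = Function.update h k (p k) i :=
        fun i => congrFun hup i
      have hself : h = Function.update h k (q k) := by
        funext i
        rcases eq_or_ne i k with rfl | hik
        · simp [hh, hk]
        · simp [Function.update_of_ne hik]
      -- The two products differ only in factor `k`; the others are common and each sums to one.
      have hstep : ∑ a : ∀ i, A i, |∏ i, Function.update h k (p k) i (a i) - ∏ i, h i (a i)| =
          ∑ b, |p k b - q k b| := by
        have h1 : ∀ a : ∀ i, A i,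
            |∏ i, Function.update h k (p k) i (a i) - ∏ i, h i (a i)| =
              ∏ i, Function.update h k (fun b => |p k b - q k b|) i (a i) := by
          intro a
          conv_lhs => rw [hself]
          rw [Function.update_idem, prod_update_apply, prod_update_apply, prod_update_apply,
            ← sub_mul, abs_mul, abs_of_nonneg (Finset.prod_nonneg fun i _ => (hmem i).1 _)]
        rw [Finset.sum_congr rfl fun a _ => h1 a, sum_prod_apply,
          ← Finset.mul_prod_erase Finset.univ _ (Finset.mem_univ k)]
        rw [Finset.prod_eq_one, mul_one, Function.update_self]
        intro i hi
        rw [Function.update_of_ne (Finset.ne_of_mem_erase hi)]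
        exact (hmem i).2
      simp only [hup']
      rw [Finset.sum_insert hk, ← hstep]
      refine le_trans ?_ (add_le_add_right ih _)
      rw [← Finset.sum_add_distrib]
      exact Finset.sum_le_sum fun a _ => abs_sub_le _ _ _
  simpa using key Finset.univ

lemma prodMean_const {q : ∀ i, A i → ℝ} (hq : ∀ i, q i ∈ stdSimplex ℝ (A i)) (c : ℝ) :
    prodMean q (fun _ => c) = c := by
  rw [prodMean, ← Finset.sum_mul, sum_prod_apply_eq_one hq, one_mul]

lemma prodMean_add (q : ∀ i, A i → ℝ) (f g : (∀ i, A i) → ℝ) :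
    prodMean q (fun a => f a + g a) = prodMean q f + prodMean q g := by
  simp only [prodMean, mul_add, Finset.sum_add_distrib]

lemma prodMean_sub (q : ∀ i, A i → ℝ) (f g : (∀ i, A i) → ℝ) :
    prodMean q (fun a => f a - g a) = prodMean q f - prodMean q g := by
  simp only [prodMean, mul_sub, Finset.sum_sub_distrib]

lemma prodMean_const_mul (q : ∀ i, A i → ℝ) (c : ℝ) (f : (∀ i, A i) → ℝ) :
    prodMean q (fun a => c * f a) = c * prodMean q f := by
  simp only [prodMean, Finset.mul_sum, mul_left_comm]

lemma prodMean_sum {ι : Type*} (s : Finset ι) (q : ∀ i, A i → ℝ) (f : ι → (∀ i, A i) → ℝ) :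
    prodMean q (fun a => ∑ k ∈ s, f k a) = ∑ k ∈ s, prodMean q (f k) := by
  simp only [prodMean, Finset.mul_sum]
  rw [Finset.sum_comm]

lemma prodMean_mono {q : ∀ i, A i → ℝ} (hq : ∀ i, q i ∈ stdSimplex ℝ (A i))
    {f g : (∀ i, A i) → ℝ} (h : ∀ a, f a ≤ g a) : prodMean q f ≤ prodMean q g :=
  Finset.sum_le_sum fun a _ => mul_le_mul_of_nonneg_left (h a) (prod_apply_nonneg hq a)

lemma abs_prodMean_le {q : ∀ i, A i → ℝ} (hq : ∀ i, q i ∈ stdSimplex ℝ (A i))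
    {f : (∀ i, A i) → ℝ} {C : ℝ} (h : ∀ a, |f a| ≤ C) : |prodMean q f| ≤ C := by
  rw [abs_le]
  constructor
  · rw [← prodMean_const hq (-C)]
    exact prodMean_mono hq fun a => (abs_le.mp (h a)).1
  · rw [← prodMean_const hq C]
    exact prodMean_mono hq fun a => (abs_le.mp (h a)).2

lemma abs_prodMean_sub_prodMean_le {p q : ∀ i, A i → ℝ} (hp : ∀ i, p i ∈ stdSimplex ℝ (A i))
    (hq : ∀ i, q i ∈ stdSimplex ℝ (A i)) {f : (∀ i, A i) → ℝ} {C : ℝ} (hC : 0 ≤ C)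
    (h : ∀ a, |f a| ≤ C) :
    |prodMean p f - prodMean q f| ≤ C * ∑ i, ∑ b, |p i b - q i b| := by
  rw [prodMean, prodMean, ← Finset.sum_sub_distrib]
  refine (Finset.abs_sum_le_sum_abs _ _).trans ?_
  refine le_trans ?_ (mul_le_mul_of_nonneg_left (sum_abs_prod_sub_prod_le hp hq) hC)
  rw [Finset.mul_sum]
  refine Finset.sum_le_sum fun a _ => ?_
  rw [← sub_mul, abs_mul, mul_comm]
  exact mul_le_mul_of_nonneg_right (h a) (abs_nonneg _)

-- This form turns `margAdv`, a filtered sum, into an expectation under a product distribution, so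
-- that the estimates for `prodMean` apply to it.
open scoped Classical in
lemma prodMean_update_single (q : ∀ i, A i → ℝ) (i : Fin n) (b : A i) (f : (∀ i, A i) → ℝ) :
    prodMean (Function.update q i (Pi.single b 1)) f =
      ∑ a : (∀ j, A j) with a i = b, (∏ j ∈ Finset.univ.erase i, q j (a j)) * f a := by
  rw [prodMean, Finset.sum_filter]
  refine Finset.sum_congr rfl fun a _ => ?_
  rw [prod_update_apply, Pi.single_apply]
  split_ifs <;> simp

open scoped Classical in
lemma prodMean_update_eq_sum (q : ∀ i, A i → ℝ) (i : Fin n) (p : A i → ℝ)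
    (f : (∀ i, A i) → ℝ) :
    prodMean (Function.update q i p) f =
      ∑ b, p b * prodMean (Function.update q i (Pi.single b 1)) f := by
  simp only [prodMean, Finset.mul_sum]
  rw [Finset.sum_comm]
  refine Finset.sum_congr rfl fun a _ => ?_
  simp only [prod_update_apply, Pi.single_apply]
  rw [Finset.sum_eq_single (a i)]
  · simp only [if_true]; ring
  · intro b _ hb
    simp [hb.symm]
  · simp

end ProductMean

/-! ### Exponential reweighting of a finite distribution. -/

section ExpWeights

variable {B : Type*} [Fintype B]

/-- The reweighting `p a ↦ p a * exp (x * u a) / Z` of the distribution `p`. -/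
noncomputable def expTilt (p u : B → ℝ) (x : ℝ) (a : B) : ℝ :=
  p a * Real.exp (x * u a) / ∑ b, p b * Real.exp (x * u b)

lemma sum_mul_exp_pos {p : B → ℝ} (hp : p ∈ stdSimplex ℝ B) (v : B → ℝ) :
    0 < ∑ b, p b * Real.exp (v b) := by
  have h0 : ∀ b ∈ Finset.univ, 0 ≤ p b * Real.exp (v b) :=
    fun b _ => mul_nonneg (hp.1 b) (Real.exp_pos _).le
  refine lt_of_le_of_ne (Finset.sum_nonneg h0) fun h => ?_
  have h1 := (Finset.sum_eq_zero_iff_of_nonneg h0).mp h.symm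
  have h2 : ∑ b, p b = 0 := Finset.sum_eq_zero fun b hb => by
    simpa [(Real.exp_pos _).ne'] using h1 b hb
  rw [hp.2] at h2
  exact one_ne_zero h2

lemma expTilt_mem {p : B → ℝ} (hp : p ∈ stdSimplex ℝ B) (u : B → ℝ) (x : ℝ) :
    expTilt p u x ∈ stdSimplex ℝ B := by
  have hZ := sum_mul_exp_pos hp fun b => x * u b
  refine ⟨fun a => div_nonneg (mul_nonneg (hp.1 a) (Real.exp_pos _).le) hZ.le, ?_⟩
  simp only [expTilt]
  rw [← Finset.sum_div, div_self hZ.ne']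

lemma expTilt_pos {p : B → ℝ} (hp : p ∈ stdSimplex ℝ B) (u : B → ℝ) (x : ℝ) {a : B}
    (ha : 0 < p a) : 0 < expTilt p u x a :=
  div_pos (mul_pos ha (Real.exp_pos _)) (sum_mul_exp_pos hp fun b => x * u b)

/-- With `q = p * exp v` and `p > 0` this is `(q - p)² ≤ (q - p) (log q - log p)`, true because
`log` has slope at least one on `(0, 1]`. Writing the ratio as `exp v` also covers `p = 0`. -/
lemma sq_sub_le_sub_mul_log {p v : ℝ} (hp : 0 ≤ p) (hp1 : p ≤ 1) (hpv : p * Real.exp v ≤ 1) :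
    (p * Real.exp v - p) ^ 2 ≤ (p * Real.exp v - p) * v := by
  have h1 : v + 1 ≤ Real.exp v := Real.add_one_le_exp v
  have h2 : -v + 1 ≤ Real.exp (-v) := Real.add_one_le_exp (-v)
  have h3 : Real.exp v * Real.exp (-v) = 1 := by rw [← Real.exp_add]; simp
  have he := Real.exp_pos v
  rcases le_or_gt 0 v with hv | hv
  · have hnn : 0 ≤ p * Real.exp v - p := by nlinarith
    have : p * Real.exp v - p ≤ v := by
      have h4 : p * Real.exp v * (1 - Real.exp (-v)) = p * Real.exp v - p := by
        linear_combination (-p) * h3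
      rw [← h4]
      have h5 : 0 ≤ 1 - Real.exp (-v) := by
        have := Real.exp_le_one_iff.mpr (neg_nonpos.mpr hv); linarith
      nlinarith
    rw [sq]
    exact mul_le_mul_of_nonneg_left this hnn
  · have hle1 : Real.exp v ≤ 1 := Real.exp_le_one_iff.mpr hv.le
    have hnp : p * Real.exp v - p ≤ 0 := by nlinarith
    have : v ≤ p * Real.exp v - p := by nlinarith
    rw [sq]
    exact mul_le_mul_of_nonpos_left this hnp

/-- The squared displacement of an exponential reweighting is controlled by the gain in mean. -/
lemma sum_sq_expTilt_sub_le {p : B → ℝ} (hp : p ∈ stdSimplex ℝ B) (u : B → ℝ) (x : ℝ) :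
    ∑ a, (expTilt p u x a - p a) ^ 2 ≤ x * ∑ a, (expTilt p u x a - p a) * u a := by
  have hZ := sum_mul_exp_pos hp fun b => x * u b
  set Z := ∑ b, p b * Real.exp (x * u b) with hZdef
  have hq := expTilt_mem hp u x
  have hform : ∀ a, expTilt p u x a = p a * Real.exp (x * u a - Real.log Z) := by
    intro a
    rw [Real.exp_sub, Real.exp_log hZ, expTilt]; ring
  have hle1 : ∀ {q : B → ℝ}, q ∈ stdSimplex ℝ B → ∀ a, q a ≤ 1 := fun {q} hq a => by
    rw [← hq.2]; exact Finset.single_le_sum (fun b _ => hq.1 b) (Finset.mem_univ a)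
  -- The normalizer `log Z` drops out because both distributions have mass one; for positive `p` the
  -- right side is the symmetrized Kullback–Leibler divergence.
  have hsum : x * ∑ a, (expTilt p u x a - p a) * u a =
      ∑ a, (expTilt p u x a - p a) * (x * u a - Real.log Z) := by
    have h0 : ∑ a, (expTilt p u x a - p a) = 0 := by
      rw [Finset.sum_sub_distrib, hq.2, hp.2, sub_self]
    simp only [mul_sub, Finset.sum_sub_distrib, ← Finset.sum_mul, h0, Finset.mul_sum]
    rw [zero_mul, sub_zero]
    exact Finset.sum_congr rfl fun a _ => by ring
  rw [hsum]
  refine Finset.sum_le_sum fun a _ => ?_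
  have := hle1 hq a
  rw [hform] at this ⊢
  exact sq_sub_le_sub_mul_log (hp.1 a) (hle1 hp a) this

/-- Cauchy–Schwarz turns the squared `ℓ²` displacement into `ℓ¹`; its factor is the source of
`maxActions` in the step size. -/
lemma sq_sum_abs_expTilt_sub_le {p : B → ℝ} (hp : p ∈ stdSimplex ℝ B) (u : B → ℝ) (x : ℝ) :
    (∑ a, |expTilt p u x a - p a|) ^ 2 ≤
      Fintype.card B * (x * ∑ a, (expTilt p u x a - p a) * u a) := by
  refine le_trans ?_ (mul_le_mul_of_nonneg_left (sum_sq_expTilt_sub_le hp u x) (by positivity))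
  have := sq_sum_le_card_mul_sum_sq (s := (Finset.univ : Finset B))
    (f := fun a => |expTilt p u x a - p a|)
  simpa [sq_abs] using this

/-- If the maximizers `s` of a centred function `u` have mass at least `c` and exceed the other
values by `δ`, the mean of `u` under the exponential reweighting is comparable to the maximum. -/
lemma max_le_mul_sum_expTilt {p : B → ℝ} (hp : p ∈ stdSimplex ℝ B) {u : B → ℝ}
    (hu : ∑ a, p a * u a = 0) (s : Finset B) {U c x δ : ℝ} (hU : ∀ a ∈ s, u a = U)
    (hc : 0 < c) (hcs : c ≤ ∑ a ∈ s, p a) (hx : 0 < x) (hδ : 0 < δ)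
    (hgap : ∀ b ∉ s, u b + δ ≤ U) :
    U ≤ (1 + 1 / (c * (x * δ))) * ∑ a, expTilt p u x a * u a := by
  classical
  set y := x * δ with hy
  have hypos : 0 < y := mul_pos hx hδ
  -- Scaling by `exp (-x U)` gives the maximizers weight one and every other action weight at most
  -- `exp (-y) ≤ 1 / (1 + y)`.
  set w : B → ℝ := fun a => Real.exp (x * u a - x * U) with hw
  set m := ∑ a ∈ s, p a with hm
  set T := ∑ a ∈ sᶜ, p a * w a with hT
  set R := ∑ a ∈ sᶜ, p a * (w a * u a) with hR
  have hmass : m + ∑ a ∈ sᶜ, p a = 1 := by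
    rw [hm, Finset.sum_add_sum_compl]; exact hp.2
  have hcen : m * U + ∑ a ∈ sᶜ, p a * u a = 0 := by
    rw [← hu, ← Finset.sum_add_sum_compl s, hm, Finset.sum_mul]
    congr 1
    exact Finset.sum_congr rfl fun a ha => by rw [hU a ha]
  set N := ∑ a ∈ sᶜ, p a with hN
  have hN0 : 0 ≤ N := Finset.sum_nonneg fun a _ => hp.1 a
  have hws : ∀ a ∈ s, w a = 1 := fun a ha => by simp [hw, hU a ha]
  have hwle : ∀ a ∈ sᶜ, w a * (1 + y) ≤ 1 := by
    intro a ha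
    have h1 : w a ≤ Real.exp (-y) := by
      apply Real.exp_le_exp.mpr
      have := hgap a (Finset.mem_compl.mp ha)
      rw [hy]; nlinarith
    have h2 : 1 + y ≤ Real.exp y := by linarith [Real.add_one_le_exp y]
    have h3 : Real.exp (-y) * Real.exp y = 1 := by rw [← Real.exp_add]; simp
    have h4 := (Real.exp_pos (-y)).le
    nlinarith
  have hT0 : 0 ≤ T := Finset.sum_nonneg fun a _ => mul_nonneg (hp.1 a) (Real.exp_pos _).le
  have hTN : T * (1 + y) ≤ N := by
    rw [hT, Finset.sum_mul]
    refine Finset.sum_le_sum fun a ha => ?_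
    rw [mul_assoc]
    exact mul_le_of_le_one_right (hp.1 a) (hwle a ha)
  have hmean : ∑ a, expTilt p u x a * u a = (m * U + R) / (m + T) := by
    have hE : ∀ a, Real.exp (x * u a) = w a * Real.exp (x * U) := fun a => by
      rw [hw, ← Real.exp_add]; congr 1; ring
    have hZ : ∑ b, p b * Real.exp (x * u b) = (m + T) * Real.exp (x * U) := by
      rw [← Finset.sum_add_sum_compl s, add_mul, hm, hT, Finset.sum_mul, Finset.sum_mul]
      congr 1 <;> refine Finset.sum_congr rfl fun a ha => ?_
      · rw [hE, hws a ha, one_mul]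
      · rw [hE, mul_assoc]
    have hS : ∑ a, p a * Real.exp (x * u a) * u a = (m * U + R) * Real.exp (x * U) := by
      rw [← Finset.sum_add_sum_compl s, add_mul, hm, hR, Finset.sum_mul, Finset.sum_mul,
        Finset.sum_mul]
      congr 1 <;> refine Finset.sum_congr rfl fun a ha => ?_
      · rw [hE, hws a ha, hU a ha]; ring
      · rw [hE]; ring
    have : ∑ a, expTilt p u x a * u a = (∑ a, p a * Real.exp (x * u a) * u a) /
        ∑ b, p b * Real.exp (x * u b) := by
      rw [Finset.sum_div]
      exact Finset.sum_congr rfl fun a _ => by rw [expTilt]; ring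
    rw [this, hZ, hS, mul_div_mul_right _ _ (Real.exp_pos _).ne']
  have hmpos : 0 < m := hc.trans_le hcs
  have hle : ∀ a, u a ≤ U := fun a => by
    by_cases ha : a ∈ s
    · exact (hU a ha).le
    · linarith [hgap a ha]
  have hU0 : 0 ≤ U := by
    have : ∑ a, p a * u a ≤ ∑ a, p a * U :=
      Finset.sum_le_sum fun a _ => mul_le_mul_of_nonneg_left (hle a) (hp.1 a)
    rwa [hu, ← Finset.sum_mul, hp.2, one_mul] at this
  -- Chebyshev's correlation inequality off `s`: `w` is an increasing function of `u`, and by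
  -- centring the sum of `p u` off `s` is `-(m U)`.
  have hcheb : -(m * U) * T ≤ N * R := by
    rcases hN0.eq_or_lt with h0 | hNpos
    · have hz := (Finset.sum_eq_zero_iff_of_nonneg fun a _ => hp.1 a).mp (hN.symm.trans h0.symm)
      have : T = 0 := Finset.sum_eq_zero fun a ha => by rw [hz a ha, zero_mul]
      rw [this, ← h0]; simp
    -- `a₀` is the conditional mean of `u` off `s` and `w₀` its weight; in the expanded sum of `p (w
    -- - w₀) (u - a₀)` the terms with `w₀` cancel.
    · set a₀ := -(m * U) / N with ha₀
      have ha₀N : N * a₀ = -(m * U) := by rw [ha₀]; field_simp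
      set w₀ := Real.exp (x * a₀ - x * U) with hw₀
      have hterm : ∀ a ∈ sᶜ, 0 ≤ p a * ((w a - w₀) * (u a - a₀)) := by
        intro a _
        refine mul_nonneg (hp.1 a) ?_
        rcases le_total a₀ (u a) with h | h
        · refine mul_nonneg (sub_nonneg.mpr (Real.exp_le_exp.mpr ?_)) (sub_nonneg.mpr h)
          nlinarith
        · refine mul_nonneg_of_nonpos_of_nonpos (sub_nonpos.mpr (Real.exp_le_exp.mpr ?_))
            (sub_nonpos.mpr h)
          nlinarith
      have hsum := Finset.sum_nonneg hterm
      have hexpand : ∑ a ∈ sᶜ, p a * ((w a - w₀) * (u a - a₀)) =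
          R - a₀ * T - w₀ * (∑ a ∈ sᶜ, p a * u a) + w₀ * (N * a₀) := by
        rw [hR, hT, hN]
        simp only [Finset.mul_sum, Finset.sum_mul, ← Finset.sum_sub_distrib,
          ← Finset.sum_add_distrib]
        exact Finset.sum_congr rfl fun a _ => by ring
      have hcen' : ∑ a ∈ sᶜ, p a * u a = -(m * U) := by linarith
      rw [hexpand, hcen', ha₀N] at hsum
      have : a₀ * T ≤ R := by linarith
      calc -(m * U) * T = N * (a₀ * T) := by rw [← ha₀N]; ring
        _ ≤ N * R := mul_le_mul_of_nonneg_left this hN0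
  have hmT : 0 < m + T := by linarith
  have hfac : 1 + 1 / (c * y) = (1 + c * y) / (c * y) := by
    field_simp; ring
  have hcy : 0 < c * y := mul_pos hc hypos
  rw [hmean, hfac, div_mul_div_comm, le_div_iff₀ (mul_pos hcy hmT)]
  rcases hN0.eq_or_lt with h0 | hNpos
  · have hz := (Finset.sum_eq_zero_iff_of_nonneg fun a _ => hp.1 a).mp (hN.symm.trans h0.symm)
    have hz1 : ∑ a ∈ sᶜ, p a * u a = 0 :=
      Finset.sum_eq_zero fun a ha => by rw [hz a ha, zero_mul]
    have hz2 : R = 0 := Finset.sum_eq_zero fun a ha => by rw [hz a ha, zero_mul]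
    have : U = 0 := by
      rw [hz1, add_zero] at hcen
      exact (mul_eq_zero.mp hcen).resolve_left hmpos.ne'
    simp [this, hz2]
  · have h1 : m * U * (N - T) ≤ N * (m * U + R) := by nlinarith
    have hmN : N = 1 - m := by linarith
    -- After `N = 1 - m` this reduces to `T (m + c y) ≤ m N`, which follows from `c ≤ m` and `T (1 +
    -- y) ≤ N`.
    have h2 : N * (c * y * (m + T)) ≤ (1 + c * y) * (m * (N - T)) := by
      have h3 : (1 + c * y) * (m * (N - T)) - N * (c * y * (m + T)) =
          m * N - T * (m + c * y) := by rw [hmN]; ring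
      have h4 : T * (m + c * y) ≤ T * (m * (1 + y)) := by
        refine mul_le_mul_of_nonneg_left ?_ hT0
        nlinarith
      nlinarith
    have h5 : N * (U * (c * y * (m + T))) ≤ N * ((1 + c * y) * (m * U + R)) := by
      calc N * (U * (c * y * (m + T))) = U * (N * (c * y * (m + T))) := by ring
        _ ≤ U * ((1 + c * y) * (m * (N - T))) := mul_le_mul_of_nonneg_left h2 hU0
        _ = (1 + c * y) * (m * U * (N - T)) := by ring
        _ ≤ (1 + c * y) * (N * (m * U + R)) :=
          mul_le_mul_of_nonneg_left h1 (by linarith)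
        _ = N * ((1 + c * y) * (m * U + R)) := by ring
    exact le_of_mul_le_mul_left h5 hNpos

/-- An exponential reweighting does not decrease the mass of the maximizers. -/
lemma sum_le_sum_expTilt {p : B → ℝ} (hp : p ∈ stdSimplex ℝ B) {u : B → ℝ} (s : Finset B)
    {x : ℝ} (hx : 0 ≤ x) (hs : ∀ a ∈ s, ∀ b, u b ≤ u a) :
    ∑ a ∈ s, p a ≤ ∑ a ∈ s, expTilt p u x a := by
  refine Finset.sum_le_sum fun a ha => ?_
  have hZ := sum_mul_exp_pos hp fun b => x * u b
  rw [expTilt, le_div_iff₀ hZ]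
  refine mul_le_mul_of_nonneg_left ?_ (hp.1 a)
  calc ∑ b, p b * Real.exp (x * u b) ≤ ∑ b, p b * Real.exp (x * u a) :=
        Finset.sum_le_sum fun b _ => mul_le_mul_of_nonneg_left
          (Real.exp_le_exp.mpr (mul_le_mul_of_nonneg_left (hs a ha b) hx)) (hp.1 b)
    _ = Real.exp (x * u a) := by rw [← Finset.sum_mul, hp.2, one_mul]

end ExpWeights

namespace StochasticGame

variable {n : ℕ} {S : Type*} {A : Fin n → Type*} [Fintype S] [∀ i, Fintype (A i)]
variable (G : StochasticGame n S A)

/-! ### Laws of trajectories and the Bellman equations. -/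

section Bellman

lemma sum_sum_sum_sum_comm {J : Type*} [Fintype J] (f : S → J → S → J → ℝ) :
    ∑ s, ∑ a, ∑ u, ∑ v, f s a u v = ∑ u, ∑ v, ∑ s, ∑ a, f s a u v := by
  have := Finset.sum_comm (s := Finset.univ) (t := Finset.univ)
    (f := fun (z w : S × J) => f z.1 z.2 w.1 w.2)
  simpa only [Fintype.sum_prod_type] using this

omit [Fintype S] in
lemma local_mem {π : Profile S A} (hπ : π ∈ policySet S A) (s : S) (i : Fin n) :
    π i s ∈ stdSimplex ℝ (A i) := hπ i s

/-- The law of the next state-action pair when the current one has law `x`. -/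
noncomputable def stepLaw (π : Profile S A) (x : S → (∀ i, A i) → ℝ) : S → (∀ i, A i) → ℝ :=
  start π fun s' => ∑ s, ∑ a, x s a * G.P s a s'

/-- The recursion of `law` appends a transition at the end; the Bellman equation needs it split off
at the beginning. -/
lemma law_succ_eq (π : Profile S A) (x : S → (∀ i, A i) → ℝ) (t : ℕ) :
    G.law π x (t + 1) = G.law π (G.stepLaw π x) t := by
  induction t with
  | zero => rfl
  | succ t ih => rw [law, ih]; rfl

omit [Fintype S] in
lemma start_nonneg {π : Profile S A} (hπ : π ∈ policySet S A) {μ : S → ℝ} (hμ : ∀ s, 0 ≤ μ s)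
    (s : S) (a : ∀ i, A i) : 0 ≤ start π μ s a :=
  mul_nonneg (hμ s) (prod_apply_nonneg (local_mem hπ s) a)

omit [Fintype S] in
lemma sum_start {π : Profile S A} (hπ : π ∈ policySet S A) (μ : S → ℝ) (s : S) :
    ∑ a, start π μ s a = μ s := by
  simp only [start]
  rw [← Finset.mul_sum, sum_prod_apply_eq_one (local_mem hπ s), mul_one]

lemma law_nonneg {π : Profile S A} (hπ : π ∈ policySet S A) {x : S → (∀ i, A i) → ℝ}
    (hx : ∀ s a, 0 ≤ x s a) (t : ℕ) (s : S) (a : ∀ i, A i) : 0 ≤ G.law π x t s a := by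
  induction t generalizing s a with
  | zero => exact hx s a
  | succ t ih =>
    exact mul_nonneg (Finset.sum_nonneg fun u _ => Finset.sum_nonneg fun v _ =>
      mul_nonneg (ih u v) ((G.P_mem u v).1 s)) (prod_apply_nonneg (local_mem hπ s) a)

lemma sum_law {π : Profile S A} (hπ : π ∈ policySet S A) (x : S → (∀ i, A i) → ℝ) (t : ℕ) :
    ∑ s, ∑ a, G.law π x t s a = ∑ s, ∑ a, x s a := by
  induction t generalizing x with
  | zero => rfl
  | succ t ih =>
    rw [law_succ_eq, ih]
    simp only [stepLaw, sum_start hπ]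
    rw [Finset.sum_comm]
    refine Finset.sum_congr rfl fun s _ => ?_
    rw [Finset.sum_comm]
    refine Finset.sum_congr rfl fun a _ => ?_
    rw [← Finset.mul_sum, (G.P_mem s a).2, mul_one]

lemma sum_sum_mul_pointPair (f : S → (∀ i, A i) → ℝ) (s : S) (a : ∀ i, A i) :
    ∑ u, ∑ v, f u v * pointPair u v s a = f s a := by
  rw [Finset.sum_eq_single s, Finset.sum_eq_single a]
  · simp [pointPair]
  · intro v _ hv; simp [pointPair, hv.symm]
  · simp
  · intro u _ hu; simp [pointPair, hu.symm]
  · simp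

lemma sum_sum_pointPair (s : S) (a : ∀ i, A i) :
    ∑ u, ∑ v, pointPair s a u v = 1 := by
  classical
  rw [Finset.sum_eq_single s, Finset.sum_eq_single a]
  · simp [pointPair]
  · intro v _ hv; simp [pointPair, hv]
  · simp
  · intro u _ hu; simp [pointPair, hu]
  · simp

omit [Fintype S] [∀ i, Fintype (A i)] in
lemma pointPair_nonneg (s : S) (a : ∀ i, A i) (u : S) (v : ∀ i, A i) :
    0 ≤ pointPair s a u v := by
  rw [pointPair]; split_ifs <;> norm_num

/-- Linearity of the chain in its initial law, which reduces every discounted reward to state-action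
values. -/
lemma law_eq_sum (π : Profile S A) (x : S → (∀ i, A i) → ℝ) (t : ℕ) (s : S) (a : ∀ i, A i) :
    G.law π x t s a = ∑ u, ∑ v, x u v * G.law π (pointPair u v) t s a := by
  induction t generalizing s a with
  | zero => exact (sum_sum_mul_pointPair x s a).symm
  | succ t ih =>
    simp only [law]
    simp_rw [ih]
    simp only [Finset.sum_mul, Finset.mul_sum]
    rw [sum_sum_sum_sum_comm]
    refine Finset.sum_congr rfl fun _ _ => Finset.sum_congr rfl fun _ _ =>
      Finset.sum_congr rfl fun _ _ => Finset.sum_congr rfl fun _ _ => ?_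
    ring

omit [∀ i, Fintype (A i)] in
lemma γ_pos : 0 < G.γ := G.γ_mem.1

omit [∀ i, Fintype (A i)] in
lemma one_sub_γ_pos : 0 < 1 - G.γ := sub_pos.mpr G.γ_mem.2

omit [∀ i, Fintype (A i)] in
lemma summable_pow : Summable fun t : ℕ => G.γ ^ t :=
  summable_geometric_of_lt_one G.γ_pos.le G.γ_mem.2

omit [∀ i, Fintype (A i)] in
lemma tsum_pow : ∑' t : ℕ, G.γ ^ t = 1 / (1 - G.γ) := by
  rw [tsum_geometric_of_lt_one G.γ_pos.le G.γ_mem.2, one_div]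

omit [∀ i, Fintype (A i)] in
lemma summable_pow_mul {f : ℕ → ℝ} (h0 : ∀ t, 0 ≤ f t) (h1 : ∀ t, f t ≤ 1) :
    Summable fun t => G.γ ^ t * f t :=
  Summable.of_nonneg_of_le (fun t => mul_nonneg (pow_nonneg G.γ_pos.le t) (h0 t))
    (fun t => mul_le_of_le_one_right (pow_nonneg G.γ_pos.le t) (h1 t)) G.summable_pow

omit [∀ i, Fintype (A i)] in
lemma tsum_pow_mul_mem {f : ℕ → ℝ} (h0 : ∀ t, 0 ≤ f t) (h1 : ∀ t, f t ≤ 1) :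
    ∑' t, G.γ ^ t * f t ∈ Set.Icc 0 (1 / (1 - G.γ)) := by
  refine ⟨tsum_nonneg fun t => mul_nonneg (pow_nonneg G.γ_pos.le t) (h0 t), ?_⟩
  rw [← G.tsum_pow]
  exact (G.summable_pow_mul h0 h1).tsum_le_tsum
    (fun t => mul_le_of_le_one_right (pow_nonneg G.γ_pos.le t) (h1 t)) G.summable_pow

/-- The expected reward at time `t` lies in `[0, 1]`. -/
lemma sum_law_mul_r_mem (i : Fin n) {π : Profile S A} (hπ : π ∈ policySet S A)
    {x : S → (∀ i, A i) → ℝ} (hx : ∀ s a, 0 ≤ x s a) (hx1 : ∑ s, ∑ a, x s a = 1) (t : ℕ) :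
    ∑ s, ∑ a, G.law π x t s a * G.r i s a ∈ Set.Icc (0 : ℝ) 1 := by
  have hl := G.law_nonneg hπ hx t
  refine ⟨Finset.sum_nonneg fun s _ => Finset.sum_nonneg fun a _ =>
    mul_nonneg (hl s a) (G.r_mem i s a).1, ?_⟩
  rw [← hx1, ← G.sum_law hπ x t]
  exact Finset.sum_le_sum fun s _ => Finset.sum_le_sum fun a _ =>
    mul_le_of_le_one_right (hl s a) (G.r_mem i s a).2

lemma summable_pointPair (i : Fin n) {π : Profile S A} (hπ : π ∈ policySet S A) (s : S)
    (a : ∀ i, A i) : Summable fun t : ℕ =>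
      G.γ ^ t * ∑ u, ∑ v, G.law π (pointPair s a) t u v * G.r i u v := by
  have h := G.sum_law_mul_r_mem i hπ (pointPair_nonneg s a) (sum_sum_pointPair s a)
  exact G.summable_pow_mul (fun t => (h t).1) fun t => (h t).2

lemma sum_law_mul_r_eq (i : Fin n) (π : Profile S A) (x : S → (∀ i, A i) → ℝ) (t : ℕ) :
    G.γ ^ t * ∑ u, ∑ v, G.law π x t u v * G.r i u v =
      ∑ s, ∑ a, x s a * (G.γ ^ t * ∑ u, ∑ v, G.law π (pointPair s a) t u v * G.r i u v) := by
  simp_rw [G.law_eq_sum π x t]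
  simp only [Finset.sum_mul, Finset.mul_sum]
  rw [sum_sum_sum_sum_comm]
  refine Finset.sum_congr rfl fun _ _ => Finset.sum_congr rfl fun _ _ =>
    Finset.sum_congr rfl fun _ _ => Finset.sum_congr rfl fun _ _ => ?_
  ring

lemma summable_discounted (i : Fin n) {π : Profile S A} (hπ : π ∈ policySet S A)
    (x : S → (∀ i, A i) → ℝ) : Summable fun t : ℕ =>
      G.γ ^ t * ∑ u, ∑ v, G.law π x t u v * G.r i u v := by
  simp_rw [G.sum_law_mul_r_eq i π x]
  exact summable_sum fun s _ => summable_sum fun a _ => (G.summable_pointPair i hπ s a).mul_left _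

lemma discounted_eq_sum (i : Fin n) {π : Profile S A} (hπ : π ∈ policySet S A)
    (x : S → (∀ i, A i) → ℝ) :
    G.discounted i π x = ∑ s, ∑ a, x s a * G.qValue i π s a := by
  rw [discounted]
  simp_rw [G.sum_law_mul_r_eq i π x]
  rw [Summable.tsum_finsetSum fun s _ => summable_sum fun a _ =>
    (G.summable_pointPair i hπ s a).mul_left _]
  refine Finset.sum_congr rfl fun s _ => ?_
  rw [Summable.tsum_finsetSum fun a _ => (G.summable_pointPair i hπ s a).mul_left _]
  refine Finset.sum_congr rfl fun a _ => ?_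
  rw [tsum_mul_left]
  rfl

lemma discounted_eq_step (i : Fin n) {π : Profile S A} (hπ : π ∈ policySet S A)
    (x : S → (∀ i, A i) → ℝ) :
    G.discounted i π x =
      ∑ s, ∑ a, x s a * G.r i s a + G.γ * G.discounted i π (G.stepLaw π x) := by
  rw [discounted, (G.summable_discounted i hπ x).tsum_eq_zero_add, discounted, ← tsum_mul_left]
  congr 1
  · simp [law]
  · refine tsum_congr fun t => ?_
    rw [law_succ_eq, pow_succ]; ring

lemma sum_mul_pointState (f : S → ℝ) (s : S) : ∑ u, pointState s u * f u = f s := by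
  rw [Finset.sum_eq_single s]
  · simp [pointState]
  · intro u _ hu; simp [pointState, hu]
  · simp

/-- `V = E_π Q`. -/
lemma value_eq (i : Fin n) {π : Profile S A} (hπ : π ∈ policySet S A) (s : S) :
    G.value i π s = prodMean (fun j => π j s) (G.qValue i π s) := by
  rw [value, G.discounted_eq_sum i hπ]
  simp only [start, mul_assoc, ← Finset.mul_sum]
  rw [sum_mul_pointState]
  rfl

/-- `Q = r + γ P V`. -/
lemma qValue_eq (i : Fin n) {π : Profile S A} (hπ : π ∈ policySet S A) (s : S) (a : ∀ i, A i) :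
    G.qValue i π s a = G.r i s a + G.γ * ∑ s', G.P s a s' * G.value i π s' := by
  have h : ∀ f : S → (∀ i, A i) → ℝ, ∑ u, ∑ v, pointPair s a u v * f u v = f s a := by
    intro f
    rw [Finset.sum_eq_single s, Finset.sum_eq_single a]
    · simp [pointPair]
    · intro v _ hv; simp [pointPair, hv]
    · simp
    · intro u _ hu; simp [pointPair, hu]
    · simp
  rw [qValue, G.discounted_eq_step i hπ, h, G.discounted_eq_sum i hπ]
  congr 2
  refine Finset.sum_congr rfl fun s' _ => ?_
  rw [G.value_eq i hπ, prodMean, Finset.mul_sum]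
  refine Finset.sum_congr rfl fun a' _ => ?_
  rw [stepLaw, start, h fun u v => G.P u v s', mul_assoc]

lemma value_mem (i : Fin n) {π : Profile S A} (hπ : π ∈ policySet S A) (s : S) :
    G.value i π s ∈ Set.Icc 0 (1 / (1 - G.γ)) := by
  have hp : ∀ u, 0 ≤ pointState s u := fun u => by rw [pointState]; split_ifs <;> norm_num
  have h1 : ∑ u, ∑ a, start π (pointState s) u a = 1 := by
    simp only [sum_start hπ]
    simpa using sum_mul_pointState (fun _ => (1 : ℝ)) s
  have h := G.sum_law_mul_r_mem i hπ (start_nonneg hπ hp) h1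
  exact G.tsum_pow_mul_mem (fun t => (h t).1) fun t => (h t).2

end Bellman

/-! ### The discounted visitation distribution. -/

section Visitation

/-- Probability that the state at time `t` is `s`. -/
noncomputable def stateLaw (π : Profile S A) (t : ℕ) (s : S) : ℝ :=
  ∑ a, G.law π (start π G.ρ) t s a

/-- At every time the joint action is drawn from `π` given the state alone, so the state marginal
determines the joint law. -/
lemma law_start_eq {π : Profile S A} (hπ : π ∈ policySet S A) (t : ℕ) (s : S)
    (a : ∀ i, A i) :
    G.law π (start π G.ρ) t s a = G.stateLaw π t s * ∏ i, π i s (a i) := by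
  cases t with
  | zero => rw [stateLaw, law, sum_start hπ]; rfl
  | succ t =>
    rw [stateLaw]
    simp only [law]
    rw [← Finset.mul_sum, sum_prod_apply_eq_one (local_mem hπ s), mul_one]

lemma stateLaw_zero {π : Profile S A} (hπ : π ∈ policySet S A) (s : S) :
    G.stateLaw π 0 s = G.ρ s := by
  rw [stateLaw, law, sum_start hπ]

lemma stateLaw_succ {π : Profile S A} (hπ : π ∈ policySet S A) (t : ℕ) (s' : S) :
    G.stateLaw π (t + 1) s' =
      ∑ s, G.stateLaw π t s * prodMean (fun j => π j s) fun a => G.P s a s' := by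
  rw [stateLaw]
  simp only [law]
  rw [← Finset.mul_sum, sum_prod_apply_eq_one (local_mem hπ s'), mul_one]
  refine Finset.sum_congr rfl fun s _ => ?_
  simp only [G.law_start_eq hπ, prodMean, Finset.mul_sum, mul_assoc]

lemma stateLaw_nonneg {π : Profile S A} (hπ : π ∈ policySet S A) (t : ℕ) (s : S) :
    0 ≤ G.stateLaw π t s :=
  Finset.sum_nonneg fun a _ => G.law_nonneg hπ (start_nonneg hπ G.ρ_mem.1) t s a

lemma sum_stateLaw {π : Profile S A} (hπ : π ∈ policySet S A) (t : ℕ) :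
    ∑ s, G.stateLaw π t s = 1 := by
  simp only [stateLaw]
  rw [G.sum_law hπ]
  simp only [sum_start hπ]
  exact G.ρ_mem.2

lemma stateLaw_le_one {π : Profile S A} (hπ : π ∈ policySet S A) (t : ℕ) (s : S) :
    G.stateLaw π t s ≤ 1 := by
  rw [← G.sum_stateLaw hπ t]
  exact Finset.single_le_sum (fun u _ => G.stateLaw_nonneg hπ t u) (Finset.mem_univ s)

lemma visitation_def (π : Profile S A) (s : S) :
    G.visitation π s = (1 - G.γ) * ∑' t : ℕ, G.γ ^ t * G.stateLaw π t s := rfl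

lemma visitation_mem {π : Profile S A} (hπ : π ∈ policySet S A) (s : S) :
    G.visitation π s ∈ Set.Icc (0 : ℝ) 1 := by
  have h := G.tsum_pow_mul_mem (fun t => G.stateLaw_nonneg hπ t s)
    fun t => G.stateLaw_le_one hπ t s
  have hγ := G.one_sub_γ_pos
  rw [visitation_def]
  refine ⟨mul_nonneg hγ.le h.1, ?_⟩
  calc (1 - G.γ) * _ ≤ (1 - G.γ) * (1 / (1 - G.γ)) := mul_le_mul_of_nonneg_left h.2 hγ.le
    _ = 1 := mul_one_div_cancel hγ.ne'

/-- The balance equation: time zero contributes `ρ`, and all later times arise by one transition.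
Total mass one and the performance difference lemma both come from it. -/
lemma visitation_eq {π : Profile S A} (hπ : π ∈ policySet S A) (s' : S) :
    G.visitation π s' = (1 - G.γ) * G.ρ s' +
      G.γ * ∑ s, G.visitation π s * prodMean (fun j => π j s) fun a => G.P s a s' := by
  have hs : ∀ s, Summable fun t => G.γ ^ t * G.stateLaw π t s := fun s =>
    G.summable_pow_mul (fun t => G.stateLaw_nonneg hπ t s) fun t => G.stateLaw_le_one hπ t s
  simp only [visitation_def]
  rw [(hs s').tsum_eq_zero_add, G.stateLaw_zero hπ, pow_zero, one_mul, mul_add]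
  congr 1
  simp only [G.stateLaw_succ hπ]
  have : ∀ t : ℕ, G.γ ^ (t + 1) * ∑ s, G.stateLaw π t s *
      (prodMean (fun j => π j s) fun a => G.P s a s') =
      ∑ s, (G.γ ^ t * G.stateLaw π t s) *
        (G.γ * prodMean (fun j => π j s) fun a => G.P s a s') := by
    intro t
    rw [Finset.mul_sum]
    exact Finset.sum_congr rfl fun s _ => by rw [pow_succ]; ring
  simp only [this]
  rw [Summable.tsum_finsetSum fun s _ => (hs s).mul_right _, Finset.mul_sum, Finset.mul_sum]
  refine Finset.sum_congr rfl fun s _ => ?_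
  rw [tsum_mul_right]
  ring

lemma sum_visitation {π : Profile S A} (hπ : π ∈ policySet S A) :
    ∑ s, G.visitation π s = 1 := by
  have h1 : ∀ s, ∑ s', prodMean (fun j => π j s) (fun a => G.P s a s') = 1 := fun s => by
    rw [← prodMean_sum]
    simp only [(G.P_mem s _).2]
    exact prodMean_const (local_mem hπ s) 1
  have h2 : ∑ s, G.visitation π s = (1 - G.γ) + G.γ * ∑ s, G.visitation π s := by
    conv_lhs => rw [Finset.sum_congr rfl fun s _ => G.visitation_eq hπ s]
    rw [Finset.sum_add_distrib, ← Finset.mul_sum, G.ρ_mem.2, mul_one, ← Finset.mul_sum,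
      Finset.sum_comm]
    simp only [← Finset.mul_sum, h1, mul_one]
  have h3 : (1 - G.γ) * (∑ s, G.visitation π s - 1) = 0 := by linear_combination h2
  linarith [(mul_eq_zero.mp h3).resolve_left G.one_sub_γ_pos.ne']

end Visitation

/-! ### Performance difference and Lipschitz dependence on the profile. -/

section PerformanceDifference

/-- The expected advantage `E_{a ∼ π'(· | s)} A_i^π(s, a)`. -/
noncomputable def meanAdv (i : Fin n) (π π' : Profile S A) (s : S) : ℝ :=
  prodMean (fun j => π' j s) (G.advantage i π s)

lemma advantage_eq (i : Fin n) {π : Profile S A} (hπ : π ∈ policySet S A) (s : S)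
    (a : ∀ i, A i) :
    G.advantage i π s a =
      G.r i s a + G.γ * (∑ s', G.P s a s' * G.value i π s') - G.value i π s := by
  rw [advantage, G.qValue_eq i hπ]

lemma meanAdv_self (i : Fin n) {π : Profile S A} (hπ : π ∈ policySet S A) (s : S) :
    G.meanAdv i π π s = 0 := by
  rw [meanAdv]
  change prodMean _ (fun a => G.qValue i π s a - G.value i π s) = 0
  rw [prodMean_sub, prodMean_const (local_mem hπ s), ← G.value_eq i hπ, sub_self]

/-- The reward cancels between the two Bellman equations, so only differences of values remain. -/
lemma advantage_sub (i : Fin n) {π π' : Profile S A} (hπ : π ∈ policySet S A)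
    (hπ' : π' ∈ policySet S A) (s : S) (a : ∀ i, A i) :
    G.advantage i π s a = G.advantage i π' s a -
      G.γ * (∑ s', G.P s a s' * (G.value i π' s' - G.value i π s')) +
      (G.value i π' s - G.value i π s) := by
  rw [G.advantage_eq i hπ, G.advantage_eq i hπ']
  simp only [mul_sub, Finset.sum_sub_distrib]
  ring

lemma prodMean_sum_P (q : ∀ i, A i → ℝ) (s : S) (f : S → ℝ) :
    prodMean q (fun a => ∑ s', G.P s a s' * f s') =
      ∑ s', prodMean q (fun a => G.P s a s') * f s' := by
  rw [prodMean_sum]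
  refine Finset.sum_congr rfl fun s' _ => ?_
  simp only [prodMean, Finset.sum_mul, mul_assoc]

/-- One-step form of the performance difference. -/
lemma value_sub_value (i : Fin n) {π π' : Profile S A} (hπ : π ∈ policySet S A)
    (hπ' : π' ∈ policySet S A) (s : S) :
    G.value i π' s - G.value i π s = G.meanAdv i π π' s +
      G.γ * ∑ s', prodMean (fun j => π' j s) (fun a => G.P s a s') *
        (G.value i π' s' - G.value i π s') := by
  have h : G.meanAdv i π π' s = G.meanAdv i π' π' s -
      G.γ * (∑ s', prodMean (fun j => π' j s) (fun a => G.P s a s') *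
        (G.value i π' s' - G.value i π s')) + (G.value i π' s - G.value i π s) := by
    have h1 : G.advantage i π s = fun a => G.advantage i π' s a -
        G.γ * (∑ s', G.P s a s' * (G.value i π' s' - G.value i π s')) +
        (G.value i π' s - G.value i π s) := funext fun a => G.advantage_sub i hπ hπ' s a
    rw [meanAdv, h1, prodMean_add, prodMean_sub, prodMean_const_mul, prodMean_sum_P,
      prodMean_const (local_mem hπ' s), meanAdv]
  rw [h, G.meanAdv_self i hπ']
  ring

/-- The performance difference lemma. -/
lemma sum_visitation_mul_meanAdv (i : Fin n) {π π' : Profile S A} (hπ : π ∈ policySet S A)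
    (hπ' : π' ∈ policySet S A) :
    ∑ s, G.visitation π' s * G.meanAdv i π π' s =
      (1 - G.γ) * (G.valueInit i π' - G.valueInit i π) := by
  set W : S → ℝ := fun s => G.value i π' s - G.value i π s with hW
  have h1 : ∀ s, G.meanAdv i π π' s = W s -
      G.γ * ∑ s', prodMean (fun j => π' j s) (fun a => G.P s a s') * W s' := by
    intro s
    have := G.value_sub_value i hπ hπ' s
    simp only [hW] at *
    linarith
  -- The balance equation tested against `W`; its transition terms cancel those of `h1`.
  have h2 : ∑ s', G.visitation π' s' * W s' = (1 - G.γ) * ∑ s', G.ρ s' * W s' +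
      ∑ s, G.visitation π' s *
        (G.γ * ∑ s', prodMean (fun j => π' j s) (fun a => G.P s a s') * W s') := by
    calc ∑ s', G.visitation π' s' * W s'
        = ∑ s', ((1 - G.γ) * (G.ρ s' * W s') + ∑ s, G.visitation π' s *
            (G.γ * (prodMean (fun j => π' j s) (fun a => G.P s a s') * W s'))) := by
          refine Finset.sum_congr rfl fun s' _ => ?_
          rw [G.visitation_eq hπ' s', add_mul, Finset.mul_sum, Finset.sum_mul, mul_assoc]
          congr 1
          exact Finset.sum_congr rfl fun s _ => by ring
      _ = _ := by
          rw [Finset.sum_add_distrib, ← Finset.mul_sum, Finset.sum_comm]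
          simp only [Finset.mul_sum]
  have h3 : G.valueInit i π' - G.valueInit i π = ∑ s', G.ρ s' * W s' := by
    rw [valueInit, valueInit, ← Finset.sum_sub_distrib]
    exact Finset.sum_congr rfl fun s _ => by rw [hW]; ring
  rw [h3]
  simp only [h1, mul_sub, Finset.sum_sub_distrib]
  rw [h2]
  ring

lemma valueInit_mem (i : Fin n) {π : Profile S A} (hπ : π ∈ policySet S A) :
    G.valueInit i π ∈ Set.Icc 0 (1 / (1 - G.γ)) := by
  refine ⟨Finset.sum_nonneg fun s _ => mul_nonneg (G.ρ_mem.1 s) (G.value_mem i hπ s).1, ?_⟩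
  calc G.valueInit i π ≤ ∑ s, G.ρ s * (1 / (1 - G.γ)) :=
        Finset.sum_le_sum fun s _ => mul_le_mul_of_nonneg_left (G.value_mem i hπ s).2
          (G.ρ_mem.1 s)
    _ = 1 / (1 - G.γ) := by rw [← Finset.sum_mul, G.ρ_mem.2, one_mul]

variable {G}

/-- Exploration makes the set bounded above; an unbounded `sSup` would have the default value `0`.
-/
lemma one_div_visitation_le (hexp : G.Explores) {π : Profile S A} (hπ : π ∈ policySet S A)
    (s : S) : 1 / G.visitation π s ≤ G.mismatch := by
  obtain ⟨ε, hε, h⟩ := hexp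
  refine le_csSup ⟨1 / ε, ?_⟩ ⟨π, hπ, s, rfl⟩
  rintro _ ⟨π', hπ', s', rfl⟩
  exact one_div_le_one_div_of_le hε (h π' hπ' s')

lemma visitation_pos (hexp : G.Explores) {π : Profile S A} (hπ : π ∈ policySet S A) (s : S) :
    0 < G.visitation π s := by
  obtain ⟨ε, hε, h⟩ := hexp
  exact hε.trans_le (h π hπ s)

lemma one_le_mismatch_mul (hexp : G.Explores) {π : Profile S A} (hπ : π ∈ policySet S A)
    (s : S) : 1 ≤ G.mismatch * G.visitation π s :=
  (div_le_iff₀ (visitation_pos hexp hπ s)).mp (one_div_visitation_le hexp hπ s)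

omit [∀ i, Fintype (A i)] in
lemma nonempty_state (G : StochasticGame n S A) : Nonempty S := by
  by_contra h
  rw [not_nonempty_iff] at h
  have := G.ρ_mem.2
  simp at this

lemma one_le_mismatch (hexp : G.Explores) {π : Profile S A} (hπ : π ∈ policySet S A) :
    1 ≤ G.mismatch := by
  obtain ⟨s⟩ := nonempty_state G
  have hd := G.visitation_mem hπ s
  have h1 := one_le_mismatch_mul hexp hπ s
  by_contra! h
  have := mul_lt_mul_of_pos_right h (visitation_pos hexp hπ s)
  linarith [hd.2]

open scoped Classical in
/-- Every advantage is at most the mismatch coefficient: the deviation to the joint action `a` at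
the single state `s` changes the value by at most `1 / (1 - γ)`. -/
lemma abs_advantage_le (hexp : G.Explores) (i : Fin n) {π : Profile S A}
    (hπ : π ∈ policySet S A) (s : S) (a : ∀ i, A i) : |G.advantage i π s a| ≤ G.mismatch := by
  set π' : Profile S A := fun j u => if u = s then Pi.single (a j) 1 else π j u with hπ'def
  have hπ' : π' ∈ policySet S A := by
    intro j u
    simp only [hπ'def]
    split_ifs
    · exact single_mem_stdSimplex ℝ (a j)
    · exact hπ j u
  have hs : G.meanAdv i π π' s = G.advantage i π s a := by
    rw [meanAdv, prodMean, Finset.sum_eq_single a]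
    · simp [hπ'def]
    · intro b _ hb
      obtain ⟨j, hj⟩ := Function.ne_iff.mp hb
      rw [Finset.prod_eq_zero (Finset.mem_univ j), zero_mul]
      simp [hπ'def, hj]
    · simp
  -- `π'` agrees with `π` away from `s`, so a single term of the performance difference survives.
  have hsum : G.visitation π' s * G.advantage i π s a =
      (1 - G.γ) * (G.valueInit i π' - G.valueInit i π) := by
    rw [← G.sum_visitation_mul_meanAdv i hπ hπ', Finset.sum_eq_single s, hs]
    · intro u _ hu
      have : G.meanAdv i π π' u = G.meanAdv i π π u := by
        simp only [meanAdv, hπ'def, if_neg hu]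
      rw [this, G.meanAdv_self i hπ, mul_zero]
    · simp
  have h1 := G.valueInit_mem i hπ
  have h2 := G.valueInit_mem i hπ'
  have hγ := G.one_sub_γ_pos
  have hbd : |(1 - G.γ) * (G.valueInit i π' - G.valueInit i π)| ≤ 1 := by
    rw [abs_mul, abs_of_pos hγ]
    have : |G.valueInit i π' - G.valueInit i π| ≤ 1 / (1 - G.γ) := by
      rw [abs_le]; constructor <;> linarith [h1.1, h1.2, h2.1, h2.2]
    calc _ ≤ (1 - G.γ) * (1 / (1 - G.γ)) := mul_le_mul_of_nonneg_left this hγ.le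
      _ = 1 := mul_one_div_cancel hγ.ne'
  have hd := visitation_pos hexp hπ' s
  rw [← hsum, abs_mul, abs_of_pos hd] at hbd
  calc |G.advantage i π s a| ≤ 1 / G.visitation π' s := by
        rw [le_div_iff₀ hd, mul_comm]; exact hbd
    _ ≤ G.mismatch := one_div_visitation_le hexp hπ' s

/-- The total `ℓ¹` distance of two profiles at a state. -/
noncomputable def profileDist (π π' : Profile S A) (s : S) : ℝ :=
  ∑ i, ∑ b, |π' i s b - π i s b|

lemma prodMean_P_abs_le {q : ∀ i, A i → ℝ} (hq : ∀ i, q i ∈ stdSimplex ℝ (A i)) (s : S)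
    {f : S → ℝ} {C : ℝ} (hf : ∀ s, |f s| ≤ C) :
    |∑ s', prodMean q (fun a => G.P s a s') * f s'| ≤ C := by
  rw [← prodMean_sum_P]
  refine abs_prodMean_le hq fun a => ?_
  calc |∑ s', G.P s a s' * f s'| ≤ ∑ s', |G.P s a s' * f s'| := Finset.abs_sum_le_sum_abs _ _
    _ ≤ ∑ s', G.P s a s' * C := Finset.sum_le_sum fun s' _ => by
        rw [abs_mul, abs_of_nonneg ((G.P_mem s a).1 s')]
        exact mul_le_mul_of_nonneg_left (hf s') ((G.P_mem s a).1 s')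
    _ = C := by rw [← Finset.sum_mul, (G.P_mem s a).2, one_mul]

/-- At a state where the difference `x` is largest in absolute value, the one-step identity gives `x
≤ M D + γ x`. The term `M D` bounds the mean advantage of `π'`, since that of `π` vanishes. -/
lemma abs_value_sub_le (hexp : G.Explores) (i : Fin n) {π π' : Profile S A}
    (hπ : π ∈ policySet S A) (hπ' : π' ∈ policySet S A) {D : ℝ}
    (hD : ∀ s, profileDist π π' s ≤ D) (s : S) :
    |G.value i π' s - G.value i π s| ≤ G.mismatch * D / (1 - G.γ) := by
  have hM : 0 ≤ G.mismatch := zero_le_one.trans (one_le_mismatch hexp hπ)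
  have hγ := G.one_sub_γ_pos
  have hadv : ∀ u, |G.meanAdv i π π' u| ≤ G.mismatch * D := fun u => by
    have h := abs_prodMean_sub_prodMean_le (local_mem hπ' u) (local_mem hπ u) hM
      (abs_advantage_le hexp i hπ u)
    have h0 : prodMean (fun j => π j u) (G.advantage i π u) = 0 := G.meanAdv_self i hπ u
    rw [h0, sub_zero] at h
    exact h.trans (mul_le_mul_of_nonneg_left (hD u) hM)
  have : Nonempty S := ⟨s⟩
  obtain ⟨u, hu⟩ := Finite.exists_max fun u => |G.value i π' u - G.value i π u|
  have h1 : |G.value i π' u - G.value i π u| ≤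
      G.mismatch * D + G.γ * |G.value i π' u - G.value i π u| := by
    conv_lhs => rw [G.value_sub_value i hπ hπ' u]
    refine (abs_add_le _ _).trans (add_le_add (hadv u) ?_)
    rw [abs_mul, abs_of_pos G.γ_pos]
    exact mul_le_mul_of_nonneg_left (prodMean_P_abs_le (local_mem hπ' u) u hu) G.γ_pos.le
  refine (hu s).trans ?_
  rw [le_div_iff₀ hγ]
  linarith

open scoped Classical in
lemma margAdv_eq (i : Fin n) (π : Profile S A) (s : S) (b : A i) :
    G.margAdv i π s b =
      prodMean (Function.update (fun j => π j s) i (Pi.single b 1)) (G.advantage i π s) := by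
  rw [prodMean_update_single, margAdv]

lemma meanAdv_update (i : Fin n) (π : Profile S A) (p : S → A i → ℝ) (s : S) :
    G.meanAdv i π (Function.update π i p) s = ∑ b, p s b * G.margAdv i π s b := by
  classical
  have h : (fun j => Function.update π i p j s) = Function.update (fun j => π j s) i (p s) := by
    funext j
    rcases eq_or_ne j i with rfl | hj
    · simp
    · simp [Function.update_of_ne hj]
  rw [meanAdv, h, prodMean_update_eq_sum]
  exact Finset.sum_congr rfl fun b _ => by rw [margAdv_eq]

lemma sum_mul_margAdv (i : Fin n) {π : Profile S A} (hπ : π ∈ policySet S A) (s : S) :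
    ∑ b, π i s b * G.margAdv i π s b = 0 := by
  rw [← meanAdv_update, Function.update_eq_self, G.meanAdv_self i hπ]

/-- Up to a shift which does not depend on the action, the marginalized advantage is Lipschitz in
the profile. -/
lemma abs_margAdv_add_sub_le (hexp : G.Explores) (i : Fin n) {π π' : Profile S A}
    (hπ : π ∈ policySet S A) (hπ' : π' ∈ policySet S A) {D : ℝ}
    (hD : ∀ s, profileDist π π' s ≤ D) (s : S) (b : A i) :
    |G.margAdv i π' s b + (G.value i π' s - G.value i π s) - G.margAdv i π s b| ≤
      G.mismatch * D / (1 - G.γ) := by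
  classical
  have hM : 0 ≤ G.mismatch := zero_le_one.trans (one_le_mismatch hexp hπ)
  have hγ := G.one_sub_γ_pos
  set q' : ∀ j, A j → ℝ := Function.update (fun j => π' j s) i (Pi.single b 1) with hq'def
  set q : ∀ j, A j → ℝ := Function.update (fun j => π j s) i (Pi.single b 1) with hqdef
  have hq' := update_mem_stdSimplex (local_mem hπ' s) i (single_mem_stdSimplex ℝ b)
  have hq := update_mem_stdSimplex (local_mem hπ s) i (single_mem_stdSimplex ℝ b)
  set W : S → ℝ := fun s => G.value i π' s - G.value i π s with hW
  -- The shift `W s` absorbs the change of the baseline value. What is left is the change of the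
  -- other agents' actions and the change of the continuation values.
  have h1 : G.margAdv i π' s b + W s - G.margAdv i π s b =
      (prodMean q' (G.advantage i π s) - prodMean q (G.advantage i π s)) +
        G.γ * ∑ s', prodMean q' (fun a => G.P s a s') * W s' := by
    have h2 : prodMean q' (G.advantage i π s) = prodMean q' (G.advantage i π' s) -
        G.γ * (∑ s', prodMean q' (fun a => G.P s a s') * W s') + W s := by
      have h3 : G.advantage i π s = fun a => G.advantage i π' s a -
          G.γ * (∑ s', G.P s a s' * W s') + W s :=
        funext fun a => G.advantage_sub i hπ hπ' s a
      rw [h3, prodMean_add, prodMean_sub, prodMean_const_mul, prodMean_sum_P, prodMean_const hq']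
    rw [margAdv_eq, margAdv_eq, h2]
    ring
  -- Agent `i` plays the same point mass in both products and contributes nothing.
  have hdist : ∑ j, ∑ c, |q' j c - q j c| ≤ D := by
    refine le_trans (Finset.sum_le_sum fun j _ => ?_) (hD s)
    rcases eq_or_ne j i with rfl | hj
    · simp only [hq'def, hqdef, Function.update_self, sub_self, abs_zero, Finset.sum_const_zero]
      exact Finset.sum_nonneg fun c _ => abs_nonneg _
    · simp [hq'def, hqdef, Function.update_of_ne hj]
  have h3 : |prodMean q' (G.advantage i π s) - prodMean q (G.advantage i π s)| ≤
      G.mismatch * D :=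
    (abs_prodMean_sub_prodMean_le hq' hq hM (abs_advantage_le hexp i hπ s)).trans
      (mul_le_mul_of_nonneg_left hdist hM)
  have h4 := prodMean_P_abs_le (G := G) hq' s (abs_value_sub_le hexp i hπ hπ' hD)
  rw [h1]
  refine (abs_add_le _ _).trans ?_
  rw [abs_mul, abs_of_pos G.γ_pos]
  calc _ ≤ G.mismatch * D + G.γ * (G.mismatch * D / (1 - G.γ)) :=
        add_le_add h3 (mul_le_mul_of_nonneg_left h4 G.γ_pos.le)
    _ = G.mismatch * D / (1 - G.γ) := by field_simp; ring

end PerformanceDifference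

end StochasticGame

namespace StochasticGame

variable {n : ℕ} {S : Type*} {A : Fin n → Type*} [Fintype S] [∀ i, Fintype (A i)]
variable (G : StochasticGame n S A)

/-! ### Ascent of the potential in one step. -/

section Ascent

lemma npgStep_eq (η : ℝ) (π : Profile S A) (i : Fin n) (s : S) :
    G.npgStep η π i s = expTilt (π i s) (G.margAdv i π s) (η / (1 - G.γ)) := by
  funext a
  simp only [npgStep, expTilt, div_mul_eq_mul_div]

lemma npgStep_mem (η : ℝ) {π : Profile S A} (hπ : π ∈ policySet S A) :
    G.npgStep η π ∈ policySet S A := fun i s => by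
  rw [npgStep_eq]
  exact expTilt_mem (hπ i s) _ _

/-- The mean advantage of the updated local policy of agent `i` at the state `s`. -/
noncomputable def npgGain (η : ℝ) (π : Profile S A) (i : Fin n) (s : S) : ℝ :=
  ∑ b, G.npgStep η π i s b * G.margAdv i π s b

/-- The sum of all `npgGain`s. -/
noncomputable def totalGain (η : ℝ) (π : Profile S A) : ℝ :=
  ∑ i, ∑ s, G.npgGain η π i s

lemma npgGain_eq (η : ℝ) {π : Profile S A} (hπ : π ∈ policySet S A) (i : Fin n) (s : S) :
    G.npgGain η π i s = ∑ b, (G.npgStep η π i s b - π i s b) * G.margAdv i π s b := by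
  simp only [sub_mul, Finset.sum_sub_distrib, sum_mul_margAdv i hπ s, sub_zero, npgGain]

lemma npgGain_nonneg {η : ℝ} (hη : 0 < η) {π : Profile S A} (hπ : π ∈ policySet S A)
    (i : Fin n) (s : S) : 0 ≤ G.npgGain η π i s := by
  have hx : 0 < η / (1 - G.γ) := div_pos hη G.one_sub_γ_pos
  have h := sum_sq_expTilt_sub_le (hπ i s) (G.margAdv i π s) (η / (1 - G.γ))
  rw [← npgStep_eq, ← G.npgGain_eq η hπ] at h
  exact nonneg_of_mul_nonneg_right ((Finset.sum_nonneg fun _ _ => sq_nonneg _).trans h) hx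

lemma sum_npgGain_nonneg {η : ℝ} (hη : 0 < η) {π : Profile S A} (hπ : π ∈ policySet S A)
    (i : Fin n) : 0 ≤ ∑ s, G.npgGain η π i s :=
  Finset.sum_nonneg fun s _ => G.npgGain_nonneg hη hπ i s

lemma totalGain_nonneg {η : ℝ} (hη : 0 < η) {π : Profile S A} (hπ : π ∈ policySet S A) :
    0 ≤ G.totalGain η π :=
  Finset.sum_nonneg fun i _ => G.sum_npgGain_nonneg hη hπ i

/-- A bound on the displacement of agent `i` in one step, uniform over the states. -/
noncomputable def agentStep (η : ℝ) (π : Profile S A) (i : Fin n) : ℝ :=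
  √(maxActions A * (η / (1 - G.γ) * ∑ s, G.npgGain η π i s))

/-- A bound on the total displacement in one step, uniform over the states. -/
noncomputable def totalStep (η : ℝ) (π : Profile S A) : ℝ :=
  √(n * (maxActions A * (η / (1 - G.γ) * G.totalGain η π)))

lemma sum_abs_npgStep_sub_le {η : ℝ} (hη : 0 < η) {π : Profile S A} (hπ : π ∈ policySet S A)
    (i : Fin n) (s : S) :
    ∑ b, |G.npgStep η π i s b - π i s b| ≤ G.agentStep η π i := by
  have hx : 0 < η / (1 - G.γ) := div_pos hη G.one_sub_γ_pos
  refine Real.le_sqrt_of_sq_le ?_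
  have h := sq_sum_abs_expTilt_sub_le (hπ i s) (G.margAdv i π s) (η / (1 - G.γ))
  rw [← npgStep_eq, ← G.npgGain_eq η hπ] at h
  have hcard : (Fintype.card (A i) : ℝ) ≤ maxActions A := by
    exact_mod_cast Finset.le_sup (f := fun i => Fintype.card (A i)) (Finset.mem_univ i)
  have hs : G.npgGain η π i s ≤ ∑ s, G.npgGain η π i s :=
    Finset.single_le_sum (fun s _ => G.npgGain_nonneg hη hπ i s) (Finset.mem_univ s)
  refine h.trans (mul_le_mul hcard (mul_le_mul_of_nonneg_left hs hx.le)
    (mul_nonneg hx.le (G.npgGain_nonneg hη hπ i s)) (Nat.cast_nonneg _))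

/-- Cauchy–Schwarz over the agents, the source of the factor `n` in the step size. -/
lemma sum_agentStep_le {η : ℝ} (hη : 0 < η) {π : Profile S A} (hπ : π ∈ policySet S A) :
    ∑ i, G.agentStep η π i ≤ G.totalStep η π := by
  have hx : 0 < η / (1 - G.γ) := div_pos hη G.one_sub_γ_pos
  refine Real.le_sqrt_of_sq_le ?_
  have h := sq_sum_le_card_mul_sum_sq (s := (Finset.univ : Finset (Fin n)))
    (f := fun i => G.agentStep η π i)
  refine h.trans (le_of_eq ?_)
  rw [Finset.card_univ, Fintype.card_fin, totalGain]
  congr 1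
  rw [Finset.mul_sum, Finset.mul_sum]
  refine Finset.sum_congr rfl fun i _ => Real.sq_sqrt ?_
  exact mul_nonneg (Nat.cast_nonneg _) (mul_nonneg hx.le (G.sum_npgGain_nonneg hη hπ i))

lemma profileDist_npgStep_le {η : ℝ} (hη : 0 < η) {π : Profile S A} (hπ : π ∈ policySet S A)
    (s : S) : profileDist π (G.npgStep η π) s ≤ G.totalStep η π :=
  (Finset.sum_le_sum fun i _ => G.sum_abs_npgStep_sub_le hη hπ i s).trans
    (G.sum_agentStep_le hη hπ)

/-- The agents below `k` play `π'`, the others play `π`. -/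
def hybrid (π π' : Profile S A) (k : ℕ) : Profile S A :=
  fun i => if (i : ℕ) < k then π' i else π i

omit [Fintype S] in
lemma hybrid_mem {π π' : Profile S A} (hπ : π ∈ policySet S A) (hπ' : π' ∈ policySet S A)
    (k : ℕ) : hybrid π π' k ∈ policySet S A := fun i => by
  simp only [hybrid]
  split_ifs
  exacts [hπ' i, hπ i]

omit [Fintype S] [∀ i, Fintype (A i)] in
lemma hybrid_self (π π' : Profile S A) (j : Fin n) : hybrid π π' j j = π j := by
  simp [hybrid]

omit [Fintype S] [∀ i, Fintype (A i)] in
lemma hybrid_succ (π π' : Profile S A) (j : Fin n) :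
    hybrid π π' (j + 1) = Function.update (hybrid π π' j) j (π' j) := by
  funext i
  rcases eq_or_ne i j with rfl | hij
  · simp [hybrid]
  · have : ((i : ℕ) < j + 1) ↔ (i : ℕ) < j := by
      have := Fin.val_ne_of_ne hij
      omega
    simp [hybrid, Function.update_of_ne hij, this]

omit [Fintype S] in
lemma profileDist_hybrid_le (π π' : Profile S A) (k : ℕ) (s : S) :
    profileDist π (hybrid π π' k) s ≤ profileDist π π' s := by
  refine Finset.sum_le_sum fun i _ => ?_
  simp only [hybrid]
  split_ifs
  · exact le_rfl
  · simpa using Finset.sum_nonneg fun b _ => abs_nonneg (π' i s b - π i s b)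

variable {G}

/-- The gain of agent `j` when it updates after the agents below it. -/
lemma le_valueInit_hybrid_sub (hexp : G.Explores) {η : ℝ} (hη : 0 < η) {π : Profile S A}
    (hπ : π ∈ policySet S A) (j : Fin n) :
    1 / (1 - G.γ) * ((∑ s, G.npgGain η π j s) / G.mismatch -
        G.agentStep η π j * (G.mismatch * G.totalStep η π / (1 - G.γ))) ≤
      G.valueInit j (hybrid π (G.npgStep η π) (j + 1)) -
        G.valueInit j (hybrid π (G.npgStep η π) j) := by
  have hγ := G.one_sub_γ_pos
  have hM : 0 < G.mismatch := zero_lt_one.trans_le (one_le_mismatch hexp hπ)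
  set π' := G.npgStep η π with hπ'def
  have hπ' : π' ∈ policySet S A := G.npgStep_mem η hπ
  set h₀ := hybrid π π' j with hh₀
  set h₁ := hybrid π π' (j + 1) with hh₁
  have hm₀ : h₀ ∈ policySet S A := hybrid_mem hπ hπ' _
  have hm₁ : h₁ ∈ policySet S A := hybrid_mem hπ hπ' _
  set L := G.mismatch * G.totalStep η π / (1 - G.γ) with hL
  have hL0 : 0 ≤ L := div_nonneg (mul_nonneg hM.le (Real.sqrt_nonneg _)) hγ.le
  have hmean : ∀ s, G.npgGain η π j s - G.agentStep η π j * L ≤ G.meanAdv j h₀ h₁ s := by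
    intro s
    set Δ := G.value j h₀ s - G.value j π s
    -- Agent `j` still plays `π j` in `h₀`, so its advantage there is centred under `π j`. The shift
    -- `Δ` may be inserted because the difference of two local policies sums to zero.
    have hsplit : G.meanAdv j h₀ h₁ s = G.npgGain η π j s +
        ∑ b, (π' j s b - π j s b) *
          (G.margAdv j h₀ s b + Δ - G.margAdv j π s b) := by
      have e1 : G.meanAdv j h₀ h₁ s = ∑ b, π' j s b * G.margAdv j h₀ s b := by
        rw [hh₁, hybrid_succ, meanAdv_update]
      have e2 : ∑ b, π j s b * G.margAdv j h₀ s b = 0 := by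
        have := sum_mul_margAdv (G := G) j hm₀ s
        rwa [hh₀, hybrid_self] at this
      have e3 : ∑ b, (π' j s b - π j s b) * Δ = 0 := by
        rw [← Finset.sum_mul, Finset.sum_sub_distrib, (hπ' j s).2, (hπ j s).2, sub_self, zero_mul]
      rw [e1, G.npgGain_eq η hπ]
      simp only [mul_sub, mul_add, Finset.sum_add_distrib, Finset.sum_sub_distrib, e3]
      simp only [sub_mul, Finset.sum_sub_distrib, e2]
      ring
    have herr : |∑ b, (π' j s b - π j s b) *
        (G.margAdv j h₀ s b + Δ - G.margAdv j π s b)| ≤ G.agentStep η π j * L := by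
      refine (Finset.abs_sum_le_sum_abs _ _).trans ?_
      refine le_trans ?_ (mul_le_mul_of_nonneg_right (G.sum_abs_npgStep_sub_le hη hπ j s) hL0)
      rw [Finset.sum_mul]
      refine Finset.sum_le_sum fun b _ => ?_
      rw [abs_mul]
      refine mul_le_mul_of_nonneg_left ?_ (abs_nonneg _)
      exact abs_margAdv_add_sub_le hexp j hπ hm₀ (fun u => (profileDist_hybrid_le π π' j u).trans
        (G.profileDist_npgStep_le hη hπ u)) s b
    rw [hsplit]
    linarith [(abs_le.mp herr).1]
  have hval := G.sum_visitation_mul_meanAdv j hm₀ hm₁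
  -- The nonnegative gains use visitation at least `1 / M`; the error, constant in `s`, uses total
  -- visitation one and loses no factor.
  have hlow : (∑ s, G.npgGain η π j s) / G.mismatch - G.agentStep η π j * L ≤
      ∑ s, G.visitation h₁ s * G.meanAdv j h₀ h₁ s := by
    calc (∑ s, G.npgGain η π j s) / G.mismatch - G.agentStep η π j * L
        ≤ ∑ s, G.visitation h₁ s * (G.npgGain η π j s - G.agentStep η π j * L) := by
          simp only [mul_sub, Finset.sum_sub_distrib]
          rw [← Finset.sum_mul, G.sum_visitation hm₁, one_mul, Finset.sum_div]
          refine sub_le_sub_right (Finset.sum_le_sum fun s _ => ?_) _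
          rw [div_le_iff₀ hM]
          nlinarith [one_le_mismatch_mul hexp hm₁ s, G.npgGain_nonneg hη hπ j s]
      _ ≤ _ := Finset.sum_le_sum fun s _ =>
          mul_le_mul_of_nonneg_left (hmean s) (G.visitation_mem hm₁ s).1
  rw [hval] at hlow
  rw [one_div_mul_eq_div, div_le_iff₀ hγ, mul_comm (G.valueInit _ _ - _)]
  exact hlow

/-- The potential under the initial distribution. -/
noncomputable def potentialInit (G : StochasticGame n S A) (Φ : Profile S A → S → ℝ)
    (π : Profile S A) : ℝ :=
  ∑ s, G.ρ s * Φ π s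

lemma valueInit_update_sub {Φ : Profile S A → S → ℝ} (hΦ : G.IsPotential Φ) {π : Profile S A}
    (hπ : π ∈ policySet S A) (i : Fin n) {p : S → A i → ℝ} (hp : p ∈ localPolicySet S (A i)) :
    G.valueInit i (Function.update π i p) - G.valueInit i π =
      G.potentialInit Φ (Function.update π i p) - G.potentialInit Φ π := by
  simp only [valueInit, potentialInit, ← Finset.sum_sub_distrib, ← mul_sub]
  exact Finset.sum_congr rfl fun s _ => by rw [hΦ i s π hπ p hp]

/-- One step of independent natural policy gradient increases the potential. -/
lemma totalGain_le_potentialInit_sub (hn : 1 ≤ n) [∀ i, Nonempty (A i)] (hexp : G.Explores)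
    {Φ : Profile S A → S → ℝ} (hΦ : G.IsPotential Φ) {η : ℝ}
    (hη : η = (1 - G.γ) ^ 2 / (4 * n * G.mismatch ^ 3 * maxActions A)) (hη0 : 0 < η)
    {π : Profile S A} (hπ : π ∈ policySet S A) :
    G.totalGain η π / (2 * G.mismatch * (1 - G.γ)) ≤
      G.potentialInit Φ (G.npgStep η π) - G.potentialInit Φ π := by
  have hγ := G.one_sub_γ_pos
  have hM1 : 1 ≤ G.mismatch := one_le_mismatch hexp hπ
  have hM : 0 < G.mismatch := zero_lt_one.trans_le hM1
  have hT := G.totalGain_nonneg hη0 hπ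
  set π' := G.npgStep η π with hπ'def
  have hπ' : π' ∈ policySet S A := G.npgStep_mem η hπ
  -- Consecutive hybrids differ in one agent, so each increment of the potential is an increment of
  -- that agent's own value.
  have htel : G.potentialInit Φ π' - G.potentialInit Φ π =
      ∑ j : Fin n, (G.valueInit j (hybrid π π' (j + 1)) - G.valueInit j (hybrid π π' j)) := by
    have hz : hybrid π π' 0 = π := by funext i; simp [hybrid]
    have hl : hybrid π π' n = π' := by funext i; simp [hybrid]
    have h1 := Finset.sum_range_sub (fun k => G.potentialInit Φ (hybrid π π' k)) n
    rw [hz, hl, ← Fin.sum_univ_eq_sum_range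
      (fun k => G.potentialInit Φ (hybrid π π' (k + 1)) - G.potentialInit Φ (hybrid π π' k))] at h1
    rw [← h1]
    refine Finset.sum_congr rfl fun j _ => ?_
    rw [hybrid_succ, valueInit_update_sub hΦ (hybrid_mem hπ hπ' _) j (hπ' j)]
  rw [htel]
  refine le_trans ?_ (Finset.sum_le_sum fun j _ => le_valueInit_hybrid_sub hexp hη0 hπ j)
  rw [← Finset.mul_sum, Finset.sum_sub_distrib, ← Finset.sum_div, ← Finset.sum_mul]
  change _ ≤ 1 / (1 - G.γ) * (G.totalGain η π / G.mismatch - _)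
  set E := G.totalStep η π with hE
  have hE0 : 0 ≤ E := Real.sqrt_nonneg _
  have hn' : (0 : ℝ) < n := by exact_mod_cast hn
  have hA : (0 : ℝ) < maxActions A := by
    have : 0 < Fintype.card (A ⟨0, hn⟩) := Fintype.card_pos
    exact_mod_cast this.trans_le
      (Finset.le_sup (f := fun i => Fintype.card (A i)) (Finset.mem_univ _))
  -- The step size enters here. Since `M ≥ 1`, the loss is at most half of the main term `totalGain
  -- / M`.
  have hEsq : G.mismatch * (E * E) / (1 - G.γ) = G.totalGain η π / (4 * G.mismatch ^ 2) := by
    have hx : 0 < η / (1 - G.γ) := div_pos hη0 hγ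
    rw [hE, totalStep, Real.mul_self_sqrt (by positivity), hη]
    field_simp
  have hloss : (∑ j, G.agentStep η π j) * (G.mismatch * E / (1 - G.γ)) ≤
      G.totalGain η π / (2 * G.mismatch) := by
    calc _ ≤ E * (G.mismatch * E / (1 - G.γ)) :=
          mul_le_mul_of_nonneg_right (G.sum_agentStep_le hη0 hπ) (by positivity)
      _ = G.totalGain η π / (4 * G.mismatch ^ 2) := by rw [← hEsq]; ring
      _ ≤ G.totalGain η π / (2 * G.mismatch) := by
          refine div_le_div_of_nonneg_left hT (by positivity) ?_
          nlinarith
  calc G.totalGain η π / (2 * G.mismatch * (1 - G.γ))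
      = 1 / (1 - G.γ) * (G.totalGain η π / G.mismatch - G.totalGain η π / (2 * G.mismatch)) := by
        field_simp; ring
    _ ≤ _ := by
        refine mul_le_mul_of_nonneg_left ?_ (by positivity)
        linarith

end Ascent

/-! ### NE-gap, gains and the suboptimality gap. -/

section Gap

variable {G}

lemma neGap_le_of_forall (hn : 1 ≤ n) {π : Profile S A} (hπ : π ∈ policySet S A) {C : ℝ}
    (h : ∀ i, ∀ p ∈ localPolicySet S (A i),
      G.valueInit i (Function.update π i p) - G.valueInit i π ≤ C) : G.neGap π ≤ C := by
  refine csSup_le ⟨_, ⟨0, hn⟩, π ⟨0, hn⟩, hπ _, rfl⟩ ?_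
  rintro _ ⟨i, p, hp, rfl⟩
  exact h i p hp

omit [Fintype S] in
lemma update_mem {π : Profile S A} (hπ : π ∈ policySet S A) (i : Fin n) {p : S → A i → ℝ}
    (hp : p ∈ localPolicySet S (A i)) : Function.update π i p ∈ policySet S A := by
  intro j
  rcases eq_or_ne j i with rfl | hj
  · simpa using hp
  · simpa [Function.update_of_ne hj] using hπ j

lemma potentialInit_mem {Φ : Profile S A → S → ℝ} {C : ℝ}
    (hφ : ∀ π ∈ policySet S A, ∀ s, 0 ≤ Φ π s ∧ Φ π s ≤ C) {π : Profile S A}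
    (hπ : π ∈ policySet S A) : G.potentialInit Φ π ∈ Set.Icc 0 C := by
  refine ⟨Finset.sum_nonneg fun s _ => mul_nonneg (G.ρ_mem.1 s) (hφ π hπ s).1, ?_⟩
  calc G.potentialInit Φ π ≤ ∑ s, G.ρ s * C := Finset.sum_le_sum fun s _ =>
        mul_le_mul_of_nonneg_left (hφ π hπ s).2 (G.ρ_mem.1 s)
    _ = C := by rw [← Finset.sum_mul, G.ρ_mem.2, one_mul]

/-- A deviation gains a difference of potentials, so at most the length of their range. This crude
bound serves the iterates before `K'`. -/
lemma neGap_le_potential_bound (hn : 1 ≤ n) {Φ : Profile S A → S → ℝ} (hΦ : G.IsPotential Φ)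
    {C : ℝ} (hφ : ∀ π ∈ policySet S A, ∀ s, 0 ≤ Φ π s ∧ Φ π s ≤ C) {π : Profile S A}
    (hπ : π ∈ policySet S A) : G.neGap π ≤ C := by
  refine neGap_le_of_forall hn hπ fun i p hp => ?_
  rw [valueInit_update_sub hΦ hπ i hp]
  linarith [(potentialInit_mem (G := G) hφ (update_mem hπ i hp)).2,
    (potentialInit_mem (G := G) hφ hπ).1]

/-- The gain of a deviation is a visitation-weighted sum of mean marginalized advantages. Gains are
nonnegative and visitations at most one, so no mismatch factor appears. -/
lemma neGap_le_totalGain (hn : 1 ≤ n) {η : ℝ} (hη : 0 < η) {π : Profile S A}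
    (hπ : π ∈ policySet S A) {B : ℝ} (hB : 0 ≤ B)
    (h : ∀ i s b, G.margAdv i π s b ≤ B * G.npgGain η π i s) :
    G.neGap π ≤ B * G.totalGain η π / (1 - G.γ) := by
  have hγ := G.one_sub_γ_pos
  refine neGap_le_of_forall hn hπ fun i p hp => ?_
  have hm := update_mem hπ i hp
  have hval := G.sum_visitation_mul_meanAdv i hπ hm
  rw [le_div_iff₀ hγ, mul_comm (_ - _), ← hval]
  have hg := G.npgGain_nonneg hη hπ
  calc ∑ s, G.visitation (Function.update π i p) s * G.meanAdv i π (Function.update π i p) s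
      ≤ ∑ s, B * G.npgGain η π i s := by
        refine Finset.sum_le_sum fun s _ => ?_
        have h1 : G.meanAdv i π (Function.update π i p) s ≤ B * G.npgGain η π i s := by
          rw [meanAdv_update]
          calc ∑ b, p s b * G.margAdv i π s b ≤ ∑ b, p s b * (B * G.npgGain η π i s) :=
                Finset.sum_le_sum fun b _ => mul_le_mul_of_nonneg_left (h i s b) ((hp s).1 b)
            _ = B * G.npgGain η π i s := by rw [← Finset.sum_mul, (hp s).2, one_mul]
        have hd := G.visitation_mem hm s
        calc _ ≤ G.visitation (Function.update π i p) s * (B * G.npgGain η π i s) :=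
              mul_le_mul_of_nonneg_left h1 hd.1
          _ ≤ B * G.npgGain η π i s :=
              mul_le_of_le_one_left (mul_nonneg hB (hg i s)) hd.2
    _ = B * ∑ s, G.npgGain η π i s := by rw [Finset.mul_sum]
    _ ≤ B * G.totalGain η π := by
        refine mul_le_mul_of_nonneg_left ?_ hB
        exact Finset.single_le_sum (f := fun i => ∑ s, G.npgGain η π i s)
          (fun i _ => G.sum_npgGain_nonneg hη hπ i) (Finset.mem_univ i)

lemma mem_bestActions {i : Fin n} {π : Profile S A} {s : S} {a : A i} :
    a ∈ G.bestActions i π s ↔ ∀ b, G.margAdv i π s b ≤ G.margAdv i π s a := by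
  simp [bestActions]

variable (G) in
lemma bestActions_nonempty [∀ i, Nonempty (A i)] (i : Fin n) (π : Profile S A) (s : S) :
    (G.bestActions i π s).Nonempty := by
  obtain ⟨a, ha⟩ := Finite.exists_max (G.margAdv i π s)
  exact ⟨a, mem_bestActions.mpr ha⟩

lemma subGap_le {i : Fin n} {π : Profile S A} {s : S} {a b : A i}
    (ha : a ∈ G.bestActions i π s) (hb : b ∉ G.bestActions i π s) :
    G.subGap π ≤ G.margAdv i π s a - G.margAdv i π s b := by
  refine csInf_le ⟨0, ?_⟩ ⟨i, s, a, ha, b, hb, rfl⟩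
  rintro _ ⟨j, u, c, hc, d, -, rfl⟩
  exact sub_nonneg.mpr (mem_bestActions.mp hc d)

/-- If all actions were maximizers everywhere, `subGap` would be `sInf ∅ = 0`. -/
lemma exists_notMem_bestActions {π : Profile S A} (h : 0 < G.subGap π) :
    ∃ i s, ∃ b, b ∉ G.bestActions i π s := by
  by_contra! hall
  have : G.subGap π = 0 := by
    rw [subGap, ← Real.sInf_empty]
    congr 1
    rw [Set.eq_empty_iff_forall_notMem]
    rintro _ ⟨i, s, -, -, b, hb, -⟩
    exact hb (hall i s b)
  exact h.ne' this

lemma margAdv_le_mul_npgGain [∀ i, Nonempty (A i)] {η : ℝ} (hη : 0 < η) {π : Profile S A}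
    (hπ : π ∈ policySet S A) {c δ : ℝ} (hc : 0 < c) (hδ : 0 < δ) (hgap : δ ≤ G.subGap π)
    {i : Fin n} {s : S} (hmass : c ≤ ∑ a ∈ G.bestActions i π s, π i s a) (b : A i) :
    G.margAdv i π s b ≤ (1 + 1 / (c * (η / (1 - G.γ) * δ))) * G.npgGain η π i s := by
  obtain ⟨a, ha⟩ := G.bestActions_nonempty i π s
  have hmax := mem_bestActions.mp ha
  refine (hmax b).trans ?_
  have := max_le_mul_sum_expTilt (hπ i s) (sum_mul_margAdv i hπ s) (G.bestActions i π s)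
    (U := G.margAdv i π s a) (fun a' ha' => le_antisymm (hmax a') (mem_bestActions.mp ha' a))
    hc hmass (div_pos hη G.one_sub_γ_pos) hδ
    (fun d hd => by linarith [subGap_le ha hd])
  rwa [← npgStep_eq] at this

/-- An action that is best for one profile only would have to close the other's gap, while a
difference of two advantages moves by at most `2 * ε`. -/
lemma bestActions_eq_of_close [∀ i, Nonempty (A i)] {π π' : Profile S A} {i : Fin n} {s : S}
    {ε : ℝ} (hclose : ∀ b, |G.margAdv i π' s b - G.margAdv i π s b| ≤ ε)
    (hπ : 2 * ε < G.subGap π) (hπ' : 2 * ε < G.subGap π') :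
    G.bestActions i π' s = G.bestActions i π s := by
  ext b
  have hb := abs_le.mp (hclose b)
  constructor <;> intro hmem <;> by_contra hnot
  · obtain ⟨a, ha⟩ := G.bestActions_nonempty i π s
    linarith [subGap_le ha hnot, mem_bestActions.mp hmem a, (abs_le.mp (hclose a)).1]
  · obtain ⟨a, ha⟩ := G.bestActions_nonempty i π' s
    linarith [subGap_le ha hnot, mem_bestActions.mp hmem a, (abs_le.mp (hclose a)).2]

end Gap

end StochasticGame

namespace StochasticGame

variable {n : ℕ} {S : Type*} {A : Fin n → Type*} [Fintype S] [∀ i, Fintype (A i)]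
variable {G : StochasticGame n S A}

/-! ### Positivity of the mass of the best actions. -/

section Convergence

omit [Fintype S] in
lemma softmaxPolicy_pos [∀ i, Nonempty (A i)] (θ : Profile S A) (i : Fin n) (s : S) (a : A i) :
    0 < softmaxPolicy θ i s a :=
  div_pos (Real.exp_pos _) (Finset.sum_pos (fun _ _ => Real.exp_pos _) Finset.univ_nonempty)

omit [Fintype S] in
lemma softmaxPolicy_mem [∀ i, Nonempty (A i)] (θ : Profile S A) :
    softmaxPolicy θ ∈ policySet S A := fun i s => by
  refine ⟨fun a => (softmaxPolicy_pos θ i s a).le, ?_⟩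
  simp only [softmaxPolicy]
  rw [← Finset.sum_div, div_self]
  exact (Finset.sum_pos (fun _ _ => Real.exp_pos _) Finset.univ_nonempty).ne'

lemma npg_mem (η : ℝ) {π₀ : Profile S A} (h : π₀ ∈ policySet S A) (k : ℕ) :
    G.npg η π₀ k ∈ policySet S A := by
  induction k with
  | zero => exact h
  | succ k ih => exact G.npgStep_mem η ih

lemma npg_pos (η : ℝ) {π₀ : Profile S A} (h : π₀ ∈ policySet S A)
    (hpos : ∀ i s a, 0 < π₀ i s a) (k : ℕ) (i : Fin n) (s : S) (a : A i) :
    0 < G.npg η π₀ k i s a := by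
  induction k with
  | zero => exact hpos i s a
  | succ k ih =>
    change 0 < G.npgStep η (G.npg η π₀ k) i s a
    rw [npgStep_eq]
    exact expTilt_pos (npg_mem η h k i s) _ _ ih

/-- The factor `2` pays once for the Lipschitz bound up to a shift and once for removing the shift.
-/
lemma abs_margAdv_npgStep_sub_le (hexp : G.Explores) {η : ℝ} (hη : 0 < η) {π : Profile S A}
    (hπ : π ∈ policySet S A) (i : Fin n) (s : S) (b : A i) :
    |G.margAdv i (G.npgStep η π) s b - G.margAdv i π s b| ≤
      2 * (G.mismatch * G.totalStep η π / (1 - G.γ)) := by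
  have hπ' := G.npgStep_mem η hπ
  have hD := fun s => G.profileDist_npgStep_le hη hπ s
  have h1 := abs_le.mp (abs_margAdv_add_sub_le hexp i hπ hπ' hD s b)
  have h2 := abs_le.mp (abs_value_sub_le hexp i hπ hπ' hD s)
  rw [abs_le]
  constructor <;> linarith [h1.1, h1.2, h2.1, h2.2]

lemma sum_bestActions_npgStep {η : ℝ} (hη : 0 < η) {π : Profile S A}
    (hπ : π ∈ policySet S A) (i : Fin n) (s : S) :
    ∑ a ∈ G.bestActions i π s, π i s a ≤ ∑ a ∈ G.bestActions i π s, G.npgStep η π i s a := by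
  rw [npgStep_eq]
  exact sum_le_sum_expTilt (hπ i s) _ (div_pos hη G.one_sub_γ_pos).le
    fun a ha b => mem_bestActions.mp ha b

lemma tendsto_totalStep {η : ℝ} {π : ℕ → Profile S A}
    (h : Summable fun k => G.totalGain η (π k)) :
    Tendsto (fun k => G.totalStep η (π k)) atTop (𝓝 0) := by
  have := (((h.tendsto_atTop_zero.const_mul (η / (1 - G.γ))).const_mul
    (maxActions A : ℝ)).const_mul (n : ℝ)).sqrt
  simpa [totalStep] using this

lemma bestMass_le (π : ℕ → Profile S A) (hπ : ∀ k, π k ∈ policySet S A) (i : Fin n) (s : S)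
    (k : ℕ) : G.bestMass π ≤ ∑ a ∈ G.bestActions i (π k) s, π k i s a := by
  refine ciInf_le (f := fun q : Fin n × S × ℕ =>
    ∑ a ∈ G.bestActions q.1 (π q.2.2) q.2.1, π q.2.2 q.1 q.2.1 a) ⟨0, ?_⟩ (i, s, k)
  rintro _ ⟨q, rfl⟩
  exact Finset.sum_nonneg fun a _ => (hπ q.2.2 q.1 q.2.1).1 a

lemma bestMass_lt_one {π : ℕ → Profile S A} (hπ : ∀ k, π k ∈ policySet S A)
    (hpos : ∀ k i s a, 0 < π k i s a) {k : ℕ} (hk : 0 < G.subGap (π k)) :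
    G.bestMass π < 1 := by
  obtain ⟨i, s, b, hb⟩ := exists_notMem_bestActions hk
  refine (bestMass_le π hπ i s k).trans_lt ?_
  rw [← (hπ k i s).2]
  exact Finset.sum_lt_sum_of_subset (Finset.subset_univ _) (Finset.mem_univ b) hb (hpos k i s b)
    fun a _ _ => (hπ k i s).1 a

/-- If the mass of the best actions is eventually nondecreasing, its infimum is positive. -/
lemma bestMass_pos [∀ i, Nonempty (A i)] (hn : 1 ≤ n) {π : ℕ → Profile S A}
    (hpos : ∀ k i s a, 0 < π k i s a) {N : ℕ}
    (hmono : ∀ k ≥ N, ∀ i s, ∑ a ∈ G.bestActions i (π k) s, π k i s a ≤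
      ∑ a ∈ G.bestActions i (π (k + 1)) s, π (k + 1) i s a) : 0 < G.bestMass π := by
  have hS := nonempty_state G
  have : Nonempty (Fin n) := ⟨⟨0, hn⟩⟩
  set m : ℕ → Fin n × S → ℝ := fun k q => ∑ a ∈ G.bestActions q.1 (π k) q.2, π k q.1 q.2 a with hm
  have hmpos : ∀ k q, 0 < m k q := fun k q =>
    Finset.sum_pos (fun a _ => hpos k q.1 q.2 a) (G.bestActions_nonempty _ _ _)
  -- The minimum over times `0, …, N` is a lower bound for all times, as later masses dominate those
  -- at time `N`.
  obtain ⟨z, hz⟩ := Finite.exists_min fun z : Fin (N + 1) × Fin n × S => m z.1 z.2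
  refine (hmpos z.1 z.2).trans_le (le_ciInf fun q => ?_)
  change m z.1 z.2 ≤ m q.2.2 (q.1, q.2.1)
  rcases le_or_gt q.2.2 N with h | h
  · exact hz (⟨q.2.2, Nat.lt_succ_of_le h⟩, q.1, q.2.1)
  · have : m N (q.1, q.2.1) ≤ m q.2.2 (q.1, q.2.1) := by
      induction q.2.2, h.le using Nat.le_induction with
      | base => exact le_rfl
      | succ k hk ih => exact ih.trans (hmono k hk _ _)
    exact (hz (⟨N, Nat.lt_succ_self N⟩, q.1, q.2.1)).trans this

/-- If the total gains along the iteration are summable and the suboptimality gaps converge to a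
positive limit, the mass of the best actions stays away from zero. -/
lemma bestMass_pos_of_summable [∀ i, Nonempty (A i)] (hn : 1 ≤ n) (hexp : G.Explores) {η : ℝ}
    (hη : 0 < η) {π : ℕ → Profile S A} (hπ : ∀ k, π k ∈ policySet S A)
    (hpos : ∀ k i s a, 0 < π k i s a) (hstep : ∀ k, π (k + 1) = G.npgStep η (π k))
    (hsum : Summable fun k => G.totalGain η (π k)) {δ : ℝ} (hδpos : 0 < δ)
    (hδ : Tendsto (fun k => G.subGap (π k)) atTop (𝓝 δ)) : 0 < G.bestMass π := by
  have h1 : Tendsto (fun k => 2 * (G.mismatch * G.totalStep η (π k) / (1 - G.γ))) atTop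
      (𝓝 0) := by
    simpa using (((tendsto_totalStep hsum).const_mul G.mismatch).div_const (1 - G.γ)).const_mul 2
  -- Moves below `δ / 4` and gaps above `δ / 2` are what stability of the best actions needs.
  have e1 : ∀ᶠ k in atTop, 2 * (G.mismatch * G.totalStep η (π k) / (1 - G.γ)) < δ / 4 :=
    h1.eventually_lt_const (by positivity)
  have e2 : ∀ᶠ k in atTop, δ / 2 < G.subGap (π k) := hδ.eventually_const_lt (by linarith)
  obtain ⟨N, hN⟩ := eventually_atTop.mp (e1.and e2)
  refine bestMass_pos hn hpos (N := N) fun k hk i s => ?_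
  have hbest : G.bestActions i (π (k + 1)) s = G.bestActions i (π k) s := by
    refine bestActions_eq_of_close (ε := δ / 4) (fun b => ?_) ?_ ?_
    · rw [hstep]
      exact (abs_margAdv_npgStep_sub_le hexp hη (hπ k) i s b).trans (hN k hk).1.le
    · linarith [(hN k hk).2]
    · linarith [(hN (k + 1) (by omega)).2]
  rw [hbest, hstep]
  exact sum_bestActions_npgStep hη (hπ k) i s

end Convergence

end StochasticGame
-- Assembly of the convergence bound.
theorem theorem3 {n : ℕ} (hn : 1 ≤ n) {S : Type*} {A : Fin n → Type*} [Fintype S]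
    [∀ i, Fintype (A i)] [∀ i, Nonempty (A i)] (G : StochasticGame n S A)
    -- a global potential with `0 ≤ Φ^π(s) ≤ φ_max / (1 - γ)`
    (Φ : Profile S A → S → ℝ) (hΦ : G.IsPotential Φ) (φmax : ℝ)
    (hφ : ∀ π ∈ policySet S A, ∀ s, 0 ≤ Φ π s ∧ Φ π s ≤ φmax / (1 - G.γ))
    (hexp : G.Explores) (hiso : G.IsolatedStationary)
    -- the step size and the iterates, from an arbitrary softmax policy
    (η : ℝ) (hη : η = (1 - G.γ) ^ 2 / (4 * n * G.mismatch ^ 3 * maxActions A))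
    (θ : Profile S A) (π : ℕ → Profile S A) (hπ : π = G.npg η (softmaxPolicy θ))
    -- the suboptimality gaps have a positive limit
    (δstar : ℝ) (hδpos : 0 < δstar)
    (hδ : Tendsto (fun k => G.subGap (π k)) atTop (𝓝 δstar)) :
    G.bestMass π ∈ Set.Ioo (0 : ℝ) 1 ∧
    (∃ K' : ℕ, ∀ k ≥ K', |G.subGap (π k) - δstar| ≤ δstar / 2) ∧
    ∀ K' : ℕ, (∀ k ≥ K', |G.subGap (π k) - δstar| ≤ δstar / 2) →
      ∀ K : ℕ, 1 ≤ K →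
        1 / (K : ℝ) * ∑ k ∈ Finset.range K, G.neGap (π k) ≤
          2 * G.mismatch * φmax / (K * (1 - G.γ)) *
            (1 + 8 * n * G.mismatch ^ 3 * maxActions A / (G.bestMass π * δstar * (1 - G.γ))
              + K' / (2 * G.mismatch)) := by
  open StochasticGame in
  have hmem : ∀ k, π k ∈ policySet S A := fun k => hπ ▸ npg_mem η (softmaxPolicy_mem θ) k
  have hpos : ∀ k i s a, 0 < π k i s a := fun k => by
    rw [hπ]
    exact npg_pos η (softmaxPolicy_mem θ) (softmaxPolicy_pos θ) k
  have hstep : ∀ k, π (k + 1) = G.npgStep η (π k) := fun k => by rw [hπ]; rfl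
  have hγ := G.one_sub_γ_pos
  have hM : 0 < G.mismatch := zero_lt_one.trans_le (one_le_mismatch hexp (hmem 0))
  have hn' : (0 : ℝ) < n := by exact_mod_cast hn
  have hA : (0 : ℝ) < maxActions A := by
    have : 0 < Fintype.card (A ⟨0, hn⟩) := Fintype.card_pos
    exact_mod_cast this.trans_le
      (Finset.le_sup (f := fun i => Fintype.card (A i)) (Finset.mem_univ _))
  have hη0 : 0 < η := by rw [hη]; positivity
  have hascent : ∀ k, G.totalGain η (π k) / (2 * G.mismatch * (1 - G.γ)) ≤
      G.potentialInit Φ (π (k + 1)) - G.potentialInit Φ (π k) := fun k => by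
    rw [hstep]
    exact totalGain_le_potentialInit_sub hn hexp hΦ hη hη0 (hmem k)
  have hpot : ∀ k, G.potentialInit Φ (π k) ∈ Set.Icc 0 (φmax / (1 - G.γ)) :=
    fun k => potentialInit_mem hφ (hmem k)
  have hgain0 : ∀ k, 0 ≤ G.totalGain η (π k) := fun k => G.totalGain_nonneg hη0 (hmem k)
  have hsumle : ∀ K, ∑ k ∈ Finset.range K, G.totalGain η (π k) ≤
      2 * G.mismatch * (1 - G.γ) * (φmax / (1 - G.γ)) := fun K => by
    have h1 := Finset.sum_le_sum fun k (_ : k ∈ Finset.range K) => hascent k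
    rw [Finset.sum_range_sub (fun k => G.potentialInit Φ (π k)), ← Finset.sum_div,
      div_le_iff₀ (by positivity)] at h1
    refine h1.trans ?_
    rw [mul_comm]
    exact mul_le_mul_of_nonneg_left (by linarith [(hpot K).2, (hpot 0).1]) (by positivity)
  have hc0 : 0 < G.bestMass π := bestMass_pos_of_summable hn hexp hη0 hmem hpos hstep
    (summable_of_sum_range_le hgain0 hsumle) hδpos hδ
  refine ⟨⟨hc0, ?_⟩, ?_, ?_⟩
  · obtain ⟨k, hk⟩ := (hδ.eventually_const_lt hδpos).exists
    exact bestMass_lt_one hmem hpos hk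
  · obtain ⟨K', hK'⟩ := Metric.tendsto_atTop.mp hδ (δstar / 2) (by positivity)
    exact ⟨K', fun k hk => (hK' k hk).le⟩
  · intro K' hK' K hK
    set c := G.bestMass π with hc
    set B : ℝ := 1 + 8 * n * G.mismatch ^ 3 * maxActions A / (c * δstar * (1 - G.γ)) with hB
    have hB0 : 0 ≤ B := by positivity
    -- From `K'` on the gap is at least `δstar / 2`; this half turns the `4` of the step size into
    -- the `8` of the bound.
    have hBeq : 1 + 1 / (c * (η / (1 - G.γ) * (δstar / 2))) = B := by
      rw [hB, hη]
      field_simp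
      ring
    have hφ0 : 0 ≤ φmax / (1 - G.γ) := (hpot 0).1.trans (hpot 0).2
    -- The gain term is kept for early `k` too, where it is nonnegative, so that one bound on the
    -- full sum of gains suffices.
    have hterm : ∀ k, G.neGap (π k) ≤ (if k < K' then φmax / (1 - G.γ) else 0) +
        B / (1 - G.γ) * G.totalGain η (π k) := by
      intro k
      have h0 : 0 ≤ B / (1 - G.γ) * G.totalGain η (π k) :=
        mul_nonneg (div_nonneg hB0 hγ.le) (hgain0 k)
      split_ifs with hk
      · linarith [neGap_le_potential_bound hn hΦ hφ (hmem k)]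
      · rw [zero_add, div_mul_eq_mul_div]
        refine neGap_le_totalGain hn hη0 (hmem k) hB0 fun i s b => ?_
        rw [← hBeq]
        refine margAdv_le_mul_npgGain hη0 (hmem k) hc0 (by positivity) ?_
          (bestMass_le π hmem i s k) b
        linarith [(abs_le.mp (hK' k (not_lt.mp hk))).1]
    have hearly : ∑ k ∈ Finset.range K, (if k < K' then φmax / (1 - G.γ) else 0) ≤
        K' * (φmax / (1 - G.γ)) := by
      rw [← Finset.sum_filter, Finset.sum_const, nsmul_eq_mul]
      refine mul_le_mul_of_nonneg_right ?_ hφ0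
      have hsub : (Finset.range K).filter (· < K') ⊆ Finset.range K' := fun k hk =>
        Finset.mem_range.mpr (Finset.mem_filter.mp hk).2
      exact_mod_cast (Finset.card_le_card hsub).trans_eq (Finset.card_range K')
    have htotal : ∑ k ∈ Finset.range K, G.neGap (π k) ≤ K' * (φmax / (1 - G.γ)) +
        B / (1 - G.γ) * (2 * G.mismatch * (1 - G.γ) * (φmax / (1 - G.γ))) := by
      refine (Finset.sum_le_sum fun k _ => hterm k).trans ?_
      rw [Finset.sum_add_distrib, ← Finset.mul_sum]
      exact add_le_add hearly (mul_le_mul_of_nonneg_left (hsumle K) (div_nonneg hB0 hγ.le))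
    have hK0 : (0 : ℝ) < K := by exact_mod_cast hK
    calc 1 / (K : ℝ) * ∑ k ∈ Finset.range K, G.neGap (π k)
        ≤ 1 / (K : ℝ) * (K' * (φmax / (1 - G.γ)) +
            B / (1 - G.γ) * (2 * G.mismatch * (1 - G.γ) * (φmax / (1 - G.γ)))) :=
          mul_le_mul_of_nonneg_left htotal (by positivity)
      _ = 2 * G.mismatch * φmax / (K * (1 - G.γ)) * (B + K' / (2 * G.mismatch)) := by
          field_simp
          ring
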